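/- Let $X$ be a compact metric space with Borel $\sigma$-algebra, and let $r\colon X\to X$ be a measurable map that is onto and finite-to-one. Let $\rho$ be a strongly invariant Borel probability measure on $X$, i.e. $\int f\,d\rho=\int \frac{1}{\#r^{-1}(x)}\sum_{r(y)=x}f(y)\,d\rho(x)$ for all $f\in L^\infty(X,\rho)$. Let $C=\{x_0,\dots,x_{p-1}\}$, $p\ge 1$, be a cycle of distinct points with $r(x_{i+1})=x_i$ (indices modulo $p$). Assume that $C$ is repelling: for each $i$ there are $0<a<1$ and $\delta>0$ with $d(r^p(x),x_i)>a^{-1}d(x,x_i)$ whenever $0<d(x,x_i)<\delta$. Assume that $r$ and $x\mapsto\#r^{-1}(x)$ are continuous at the points of $C$. Let $X_\infty$ be the space of paths $\omega=(z_n)_{n\ge 0}$ in $X$ with $r(z_{n+1})=z_n$ for all $n\ge0$, let $\theta_0(\omega)=z_0$ and $\hat r(z_0,z_1,\dots)=(r(z_0),z_0,z_1,\dots)$. Let $\mathbf N_C(x)$ be the set of paths with $z_0=x$ for which $z_{kp}$ converges, as $k\to\infty$, to a point $x_{i(\omega)}$ of $C$, and let $\lambda_C$ be the measure on $X_\infty$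 with $\int f\,d\lambda_C=\int_X\sum_{\omega\in\mathbf N_C(x)}f(\omega)\,d\rho(x)$. Let $\alpha_0,\dots,\alpha_{p-1}$ be complex numbers of modulus $1$. Let $m_0\in L^\infty(X,\rho)$ be a function $X\to\mathbb C$ such that $\frac{1}{\#r^{-1}(x)}\sum_{r(y)=x}|m_0(y)|^2=1$ for all $x\in X$, $m_0(x_i)=\alpha_i\sqrt{\#r^{-1}(r(x_i))}$ for all $i$, and, at each $x_i$, $|m_0(x)-m_0(x_i)|\le\beta(d(x,x_i))$ for $x$ near $x_i$, for some non-decreasing $\beta\colon[0,\infty)\to[0,\infty)$ with $\sum_{k\ge1}\beta(Aa^k)<\infty$ for all $A>0$, $0<a<1$. Put $$\hat\varphi(\omega)=\prod_{k\ge1}\frac{\alpha_{i(\omega)+k}^{-1}\,m_0(z_k)}{\sqrt{\#r^{-1}(r(z_k))}}.$$ Let $W(x)=|m_0(x)|^2/\#r^{-1}(r(x))$, let $P_x$ be the law on $X_\infty$ of the random walk $z_0=x,z_1,z_2,\dots$ that moves from $z$ to $y\in r^{-1}(z)$ with probability $W(y)$, and let $h_C(x)=P_x(\mathbf N_C(x))$.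 Then $\hat\varphi\in L^2(X_\infty,\lambda_C)$, and the formula $U\xi(\omega)=\alpha_{i(\omega)}\sqrt{\#r^{-1}(r(z_0))}\;\xi(\hat r(\omega))$ defines a unitary operator $U$ on $L^2(X_\infty,\lambda_C)$. For $f\in L^\infty(X,\rho)$ let $\pi(f)$ be multiplication by $f\circ\theta_0$ on $L^2(X_\infty,\lambda_C)$, and let $V_0$ be the closure of $\{\pi(f)\hat\varphi\mid f\in L^\infty(X,\rho)\}$. For every $n\in\mathbb N$ (including $n=0$) the space $U^{-n}V_0$ is invariant under $\pi$, and the restriction of $\pi$ to $U^{-n}V_0$ has the multiplicity function $$d_{U^{-n}V_0}(x)=\#\bigl(r^{-n}(x)\cap\{z\in X\mid h_C(z)\ne0\}\bigr).$$ Here a multiplicity function of a representation $\pi$ of $L^\infty(X,\rho)$ on a Hilbert space $\mathcal H$ is a ($\rho$-almost everywhere) measurable function $d\colon X\to\{0,1,2,\dots,\infty\}$ for which, with $X_k=\{x\mid d(x)\ge k\}$, there is an isometric isomorphism $\mathcal J=(\mathcal J_k)_{k\ge1}\colon\mathcal H\to\bigoplus_{k\ge1}L^2(X_k,\rho)$ such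 that $\mathcal J_k\pi(f)\psi=f\,\mathcal J_k\psi$ for all $f$, $\psi$, $k$. The displayed function is a multiplicity function, and every multiplicity function of this restricted representation agrees with it $\rho$-almost everywhere. -/

import Mathlib

open MeasureTheory ProbabilityTheory Filter Topology
open scoped ENNReal

noncomputable section

namespace CycleRep

/-! ### Endomorphisms, cycles and paths -/

section Paths

variable {X : Type*}

/-- The cardinality `#r⁻¹(x)` of the fibre over `x` (all fibres are finite in the application). -/
def fibreCard (r : X → X) (x : X) : ℕ := (r ⁻¹' {x}).ncard

/-- `ρ` is strongly invariant:
`∫ f dρ = ∫ (1 / #r⁻¹(x)) ∑_{r(y) = x} f(y) dρ(x)` for all `f ∈ L^∞(ρ)`. -/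
def StronglyInvariant [MeasurableSpace X] (r : X → X) (ρ : Measure X) : Prop :=
  ∀ f : X → ℂ, MemLp f ∞ ρ →
    ∫ x, f x ∂ρ = ∫ x, (1 / (fibreCard r x : ℂ)) * ∑ᶠ y ∈ r ⁻¹' {x}, f y ∂ρ

/-- The points `c 0, …, c (p - 1)`, indexed modulo `p`, are distinct and form a cycle of
length `p`, traversed backwards: `r (c (i + 1)) = c i`. -/
def IsCycle (r : X → X) {p : ℕ} (c : ZMod p → X) : Prop :=
  Function.Injective c ∧ ∀ i, r (c (i + 1)) = c i

/-- `x₀` is a repelling fixed point of `g`. -/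
def IsRepellingFixedPoint [MetricSpace X] (g : X → X) (x₀ : X) : Prop :=
  g x₀ = x₀ ∧ ∃ a δ : ℝ, 0 < a ∧ a < 1 ∧ 0 < δ ∧
    ∀ x, x ≠ x₀ → dist x x₀ < δ → a⁻¹ * dist x x₀ < dist (g x) x₀

/-- A cycle of length `p` is repelling if each of its points is repelling for `r^p`. -/
def IsRepellingCycle [MetricSpace X] (r : X → X) {p : ℕ} (c : ZMod p → X) : Prop :=
  ∀ i, IsRepellingFixedPoint (r^[p]) (c i)

/-- `f` is `β`-Lipschitz at `x₀` for some gauge `β` that is summable along geometric sequences. -/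
def IsBetaLipschitzAt [MetricSpace X] (f : X → ℂ) (x₀ : X) : Prop :=
  ∃ β : ℝ → ℝ, MonotoneOn β (Set.Ici 0) ∧ (∀ t, 0 ≤ t → 0 ≤ β t) ∧
    (∀ A a : ℝ, 0 < A → 0 < a → a < 1 → Summable fun k : ℕ => β (A * a ^ (k + 1))) ∧
    ∀ᶠ x in 𝓝 x₀, ‖f x - f x₀‖ ≤ β (dist x x₀)

/-- The space `X_∞` of infinite paths.  A path `(z₁, z₂, …)` starting at `x` is stored together
with its starting point `z₀ = x`; it satisfies `r (z_{n+1}) = z_n` for all `n ≥ 0`.  The topology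
and the σ-algebra are the ones inherited from the product `X^ℕ`. -/
abbrev PathSpace (r : X → X) : Type _ := {z : ℕ → X // ∀ n, r (z (n + 1)) = z n}

/-- The coordinate map `θ₀`: the starting point of a path. -/
def start {r : X → X} (ω : PathSpace r) : X := ω.1 0

/-- The map `r̂`: the path `(z₁, z₂, …)` starting at `x` goes to the path `(x, z₁, z₂, …)`
starting at `r x`. -/
def shift {r : X → X} (ω : PathSpace r) : PathSpace r :=
  ⟨fun n => Nat.casesOn n (r (ω.1 0)) ω.1, fun n => by
    cases n with
    | zero => rfl
    | succ n => exact ω.2 n⟩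

/-- `N_C(x)`: the paths `(z₁, z₂, …)` that start at `x` and for which `z_{kp}` converges to a
point of the cycle. -/
def cyclePaths [TopologicalSpace X] (r : X → X) {p : ℕ} (c : ZMod p → X) (x : X) :
    Set (PathSpace r) :=
  {ω | start ω = x ∧ ∃ i, Tendsto (fun k : ℕ => ω.1 (k * p)) atTop (𝓝 (c i))}

open Classical in
/-- The index `i(ω)` with `z_{kp} → c (i(ω))` (equal to `0` if there is no such index). -/
def cycleIndex [TopologicalSpace X] {r : X → X} {p : ℕ} (c : ZMod p → X) (ω : PathSpace r) :
    ZMod p :=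
  if h : ∃ i, Tendsto (fun k : ℕ => ω.1 (k * p)) atTop (𝓝 (c i)) then h.choose else 0

/-- The measure `λ_C` on `X_∞`: `∫ f dλ_C = ∫ ∑_{ω ∈ N_C(x)} f(ω) dρ(x)`. -/
def cycleMeasure [TopologicalSpace X] [MeasurableSpace X] (r : X → X) (ρ : Measure X)
    {p : ℕ} (c : ZMod p → X) : Measure (PathSpace r) :=
  ρ.bind fun x => Measure.sum fun ω : cyclePaths r c x => Measure.dirac (ω : PathSpace r)

/-- The scaling function
`φ̂(ω) = ∏_{k ≥ 1} α_{i(ω) + k}⁻¹ m₀(z_k) / √#r⁻¹(r(z_k))`. -/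
def scalingFunction [TopologicalSpace X] (r : X → X) {p : ℕ} (c : ZMod p → X) (α : ZMod p → ℂ)
    (m₀ : X → ℂ) (ω : PathSpace r) : ℂ :=
  ∏' k : ℕ, (α (cycleIndex c ω + ((k + 1 : ℕ) : ZMod p)))⁻¹ * m₀ (ω.1 (k + 1)) /
    (Real.sqrt (fibreCard r (r (ω.1 (k + 1)))) : ℂ)

end Paths

/-! ### The random walk measures `P_x` and the harmonic function `h_C` -/

section Walk

variable {X : Type*}

/-- The set `X` with the σ-algebra of all subsets.  The random walk below moves along finite
fibres, so that its law may be built without any measurability condition on the weight. -/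
def Disc (X : Type*) : Type _ := X

instance (X : Type*) : MeasurableSpace (Disc X) := ⊤

/-- A point of `X` as a point of `Disc X`. -/
def Disc.of (x : X) : Disc X := x

/-- A point of `Disc X` as a point of `X`. -/
def Disc.val (x : Disc X) : X := x

open Classical in
/-- One step of the random walk with weight `W`: from `x` it goes to `y ∈ r⁻¹(x)` with probability
`W y`.  (Where the weights of the fibre do not add up to `1`, it stays where it is.) -/
def stepMeasure (r : X → X) (W : X → ℝ) (x : Disc X) : Measure (Disc X) :=
  let μ : Measure (Disc X) := Measure.sum fun y : r ⁻¹' {x.val} =>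
    ENNReal.ofReal (W y) • Measure.dirac (Disc.of (y : X))
  if μ Set.univ = 1 then μ else Measure.dirac x

instance (r : X → X) (W : X → ℝ) (x : Disc X) : IsProbabilityMeasure (stepMeasure r W x) := by
  unfold stepMeasure
  dsimp only
  split_ifs with h
  · exact ⟨h⟩
  · infer_instance

/-- The transition kernels of the random walk: the next point depends on the last one. -/
def stepKernel (r : X → X) (W : X → ℝ) (n : ℕ) :
    Kernel (Π _ : Finset.Iic n, Disc X) (Disc X) where
  toFun z := stepMeasure r W (z ⟨n, Finset.mem_Iic.2 le_rfl⟩)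
  measurable' := (measurable_from_top (f := stepMeasure r W)).comp (measurable_pi_apply _)

instance (r : X → X) (W : X → ℝ) (n : ℕ) : IsMarkovKernel (stepKernel r W n) :=
  ⟨fun z => inferInstanceAs
    (IsProbabilityMeasure (stepMeasure r W (z ⟨n, Finset.mem_Iic.2 le_rfl⟩)))⟩

/-- The measure `P_x` on `X_∞`: the law of the random walk `x = z₀, z₁, z₂, …`, so that
`P_x {z₁ = a₁, …, z_n = a_n} = W(a₁) ⋯ W(a_n)` for every path `(a₁, a₂, …)` starting at `x`. -/
def walkMeasure [MeasurableSpace X] (r : X → X) (W : X → ℝ) (x : X) : Measure (PathSpace r) :=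
  Measure.comap Subtype.val
    (Measure.map (fun (z : ℕ → Disc X) (n : ℕ) => (z n).val)
      (Kernel.traj (X := fun _ => Disc X) (stepKernel r W) 0 fun _ => Disc.of x))

/-- The weight `W(x) = |m₀(x)|² / #r⁻¹(r(x))`. -/
def filterWeight (r : X → X) (m₀ : X → ℂ) (x : X) : ℝ := ‖m₀ x‖ ^ 2 / fibreCard r (r x)

/-- The harmonic function `h_C(x) = P_x(N_C(x))` of the cycle. -/
def harmonicFunction [TopologicalSpace X] [MeasurableSpace X] (r : X → X) {p : ℕ}
    (c : ZMod p → X) (m₀ : X → ℂ) (x : X) : ℝ :=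
  (walkMeasure r (filterWeight r m₀) x).real (cyclePaths r c x)

end Walk

/-! ### The covariant representation -/

section Representation

variable {X : Type*} [TopologicalSpace X] [MeasurableSpace X]

theorem start_quasiMeasurePreserving (r : X → X) (ρ : Measure X) {p : ℕ} (c : ZMod p → X) :
    Measure.QuasiMeasurePreserving (start (r := r)) (cycleMeasure r ρ c) ρ := by
  have hm : Measurable (start (r := r)) := (measurable_pi_apply 0).comp measurable_subtype_coe
  refine ⟨hm, Measure.AbsolutelyContinuous.mk fun s hs h0 => ?_⟩
  rw [Measure.map_apply hm hs]
  refine le_antisymm ((Measure.bind_apply_le _ (hm hs)).trans ?_) bot_le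
  have : ∀ᵐ x ∂ρ, (Measure.sum fun ω : cyclePaths r c x =>
      Measure.dirac (ω : PathSpace r)) (start ⁻¹' s) = 0 := by
    filter_upwards [measure_eq_zero_iff_ae_notMem.1 h0] with x hx
    rw [Measure.sum_apply _ (hm hs), ENNReal.tsum_eq_zero]
    intro ω
    rw [Measure.dirac_apply' _ (hm hs)]
    exact Set.indicator_of_notMem (fun h => hx (by
      have h1 : start (ω : PathSpace r) ∈ s := h
      rwa [ω.2.1] at h1)) _
  rw [lintegral_congr_ae this, lintegral_zero]

theorem memLp_comp_start (r : X → X) (ρ : Measure X) {p : ℕ} (c : ZMod p → X) {f : X → ℂ}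
    (hf : MemLp f ∞ ρ) : MemLp (fun ω => f (start ω)) ∞ (cycleMeasure r ρ c) := by
  have hq := start_quasiMeasurePreserving r ρ c
  have hlt : eLpNormEssSup f ρ < ∞ := by
    rw [← eLpNorm_exponent_top]
    exact hf.2
  have h1 : AEStronglyMeasurable (fun ω : PathSpace r => f (start ω)) (cycleMeasure r ρ c) :=
    hf.aestronglyMeasurable.comp_quasiMeasurePreserving hq
  have h2 : ∀ᵐ x ∂ρ, ‖f x‖ ≤ (eLpNormEssSup f ρ).toReal := by
    filter_upwards [ae_le_eLpNormEssSup (f := f) (μ := ρ)] with x hx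
    rw [← toReal_enorm]
    exact ENNReal.toReal_mono hlt.ne hx
  have h3 : ∀ᵐ ω ∂(cycleMeasure r ρ c), ‖f (start ω)‖ ≤ (eLpNormEssSup f ρ).toReal := by
    have := hq.ae h2
    exact this
  exact memLp_top_of_bound h1 _ h3

/-- The Hilbert space `L²(X_∞, λ_C)`. -/
abbrev CycleL2 (r : X → X) (ρ : Measure X) {p : ℕ} (c : ZMod p → X) : Type _ :=
  Lp ℂ 2 (cycleMeasure r ρ c)

/-- The function `f ∘ θ₀ ∈ L^∞(X_∞, λ_C)` for `f ∈ L^∞(X, ρ)`. -/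
def pullback (r : X → X) (ρ : Measure X) {p : ℕ} (c : ZMod p → X) (f : Lp ℂ ∞ ρ) :
    Lp ℂ ∞ (cycleMeasure r ρ c) :=
  MemLp.toLp (fun ω => f (start ω)) (memLp_comp_start r ρ c (Lp.memLp f))

/-- The representation `π` of `L^∞(X, ρ)` on `L²(X_∞, λ_C)`:
`π(f) ξ (x, ω) = f(x) ξ (x, ω)`. -/
def rep (r : X → X) (ρ : Measure X) {p : ℕ} (c : ZMod p → X) (f : Lp ℂ ∞ ρ) :
    CycleL2 r ρ c →L[ℂ] CycleL2 r ρ c :=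
  (ContinuousLinearMap.mul ℂ ℂ).holderL (cycleMeasure r ρ c) ∞ 2 2 (pullback r ρ c f)

/-- `U` is the operator
`U ξ (x, ω) = α_{i(ω)} √#r⁻¹(r(x)) ξ (r̂ (x, ω))` on `L²(X_∞, λ_C)`. -/
def IsScalingOperator (r : X → X) (ρ : Measure X) {p : ℕ} (c : ZMod p → X) (α : ZMod p → ℂ)
    (U : CycleL2 r ρ c ≃ₗᵢ[ℂ] CycleL2 r ρ c) : Prop :=
  ∀ ξ : CycleL2 r ρ c, U ξ =ᵐ[cycleMeasure r ρ c] fun ω =>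
    α (cycleIndex c ω) * (Real.sqrt (fibreCard r (r (start ω))) : ℂ) * ξ (shift ω)

/-- The space `V₀`, the closure of `{π(f) φ | f ∈ L^∞(X, ρ)}`.  (That set is a linear subspace,
so taking its span changes nothing.) -/
def coreSpace (r : X → X) (ρ : Measure X) {p : ℕ} (c : ZMod p → X) (φ : CycleL2 r ρ c) :
    Submodule ℂ (CycleL2 r ρ c) :=
  (Submodule.span ℂ (Set.range fun f : Lp ℂ ∞ ρ => rep r ρ c f φ)).topologicalClosure

/-- The space `U⁻ⁿ V`. -/
def scaledSpace {H : Type*} [NormedAddCommGroup H] [InnerProductSpace ℂ H] (U : H ≃ₗᵢ[ℂ] H)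
    (n : ℕ) (V : Submodule ℂ H) : Submodule ℂ H :=
  V.map ((U⁻¹ ^ n : H ≃ₗᵢ[ℂ] H).toLinearEquiv : H →ₗ[ℂ] H)

end Representation

/-! ### Multiplicity functions -/

section Multiplicity

variable {X : Type*} [MeasurableSpace X]

/-- `V` is invariant under all the operators `π(f)`. -/
def IsInvariant {A H : Type*} [NormedAddCommGroup H] [InnerProductSpace ℂ H]
    (π : A → H →L[ℂ] H) (V : Submodule ℂ H) : Prop :=
  ∀ f, ∀ ψ ∈ V, π f ψ ∈ V

/-- The restriction of `π` to an invariant subspace. -/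
def restrictRep {A H : Type*} [NormedAddCommGroup H] [InnerProductSpace ℂ H]
    (π : A → H →L[ℂ] H) (V : Submodule ℂ H) (hV : IsInvariant π V) (f : A) : V →L[ℂ] V :=
  (π f).restrict (hV f)

/-- `d : X → {0, 1, 2, …, ∞}` is a multiplicity function of the representation `π` of
`L^∞(X, ρ)` on `H`: with `X_k = {x | d(x) ≥ k}`, `k = 1, 2, …`, there is an isometric isomorphism
`J : H → ⊕_k L²(X_k, ρ)` such that `J_k (π(f) ψ) = f · J_k ψ` for all `f`, `ψ`, `k`.
(The index `k : ℕ` of the code stands for `k + 1`.) -/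
def IsMultiplicityFunction (ρ : Measure X) {H : Type*} [NormedAddCommGroup H]
    [InnerProductSpace ℂ H] (π : Lp ℂ ∞ ρ → H →L[ℂ] H) (d : X → ℕ∞) : Prop :=
  AEMeasurable d ρ ∧
    ∃ J : H ≃ₗᵢ[ℂ] lp (fun k : ℕ => Lp ℂ 2 (ρ.restrict {x | (k : ℕ∞) + 1 ≤ d x})) 2,
      ∀ (f : Lp ℂ ∞ ρ) (ψ : H) (k : ℕ),
        J (π f ψ) k =ᵐ[ρ.restrict {x | (k : ℕ∞) + 1 ≤ d x}] fun x => f x * J ψ k x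

end Multiplicity

end CycleRep

end

noncomputable section

namespace CycleRep

/-! ### Almost everywhere measurable families of measures -/

section MeasureFamilies

variable {X Y : Type*} [MeasurableSpace X] [MeasurableSpace Y]

/-! Everything rests on the identity `∑_{ω ∈ N_C(x)} |φ̂(ω)|² = h_C(x)`. The phases have modulus 1,
so `|φ̂(ω)|²` is the infinite product of the weights `W(z_k)`, which is `P_x {ω}`; since `N_C(x)` is
countable, summation gives `P_x(N_C(x))` (`IsCycleFilter.ofReal_harmonicFunction`). The product
converges because the cycle is repelling: along a path the distance to the cycle decays
geometrically, and the gauge `β` is summable on such sequences. Countability comes from the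
quadrature condition: `W` is 1 on the cycle, hence above 1/2 nearby, so `r` is injective near each
point of the cycle and a path is determined by one late point.

Consequently `ξ ↦ φ̂ · (ξ ∘ θ₀)` is an isometry of `L²(h_C ρ)` onto `V₀` (`IsCycleFilter.map_start`,
`coreSpace_eq_range`). The covariance relation `π(f) U⁻ⁿ = U⁻ⁿ π(f ∘ rⁿ)` (`exists_rep_pow`) then
identifies `π` on `U⁻ⁿ V₀` with multiplication by `f ∘ rⁿ` on `L²(h_C ρ)`.

What remains is the multiplicity of `f ↦ f ∘ q` on `L²(h ρ)` for a finite-to-one `q`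
(`isMultiplicityFunction_of_comp`). A Borel injection into `ℝ` orders every fibre. On the set `F_k`
of points of `{h ≠ 0}` with exactly `k` predecessors in `{h ≠ 0}` in their fibre, `q` is injective,
and its image consists of the points whose fibre meets `{h ≠ 0}` at least `k + 1` times. Dividing by
the square root of a Radon–Nikodym density turns `L²(F_k, h ρ)` into `L²` of that image. For
uniqueness, where one multiplicity is `m` and another exceeds `m`, one would get `m + 1` pointwise
orthonormal vectors in `ℂ^m` (`IsMultiplicityFunction.measure_eq_zero`).

The cardinality of the fibres is not assumed measurable. Strong invariance makes it a.e. measurable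
and gives `∫ ∑_{r(y) = x} f(y) dρ(x) = ∫ #r⁻¹(r(x)) f(x) dρ(x)` (`StronglyInvariant.fibreRegular`),
so all measurability is meant modulo null sets. This formula, with the bijection of path sets given
by the shift, also makes `U` unitary. -/

theorem aemeasurable_measure_of_apply [MeasurableSpace.CountablyGenerated Y] {ρ : Measure X}
    {κ : X → Measure Y} (hfin : ∀ x, IsFiniteMeasure (κ x))
    (h : ∀ s, MeasurableSet s → AEMeasurable (fun x => κ x s) ρ) : AEMeasurable κ ρ := by
  classical
  obtain ⟨b, hb, hgen⟩ := MeasurableSpace.CountablyGenerated.isCountablyGenerated (α := Y)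
  set S := generateSetAlgebra b with hS
  have hSc : S.Countable := countable_generateSetAlgebra hb
  have hSgen : ‹MeasurableSpace Y› = .generateFrom S := by
    rw [hS, generateFrom_generateSetAlgebra_eq, hgen]
  have hSm : ∀ s ∈ S, MeasurableSet s := fun s hs => by
    rw [hSgen]; exact MeasurableSpace.measurableSet_generateFrom hs
  have halg : IsSetAlgebra S := isSetAlgebra_generateSetAlgebra
  -- A countable generating algebra allows a single null set outside which all the measurable
  -- versions are correct; the family is replaced by `0` on it.
  have hae : ∀ᵐ x ∂ρ, ∀ s : S, ∀ hs : MeasurableSet (s : Set Y),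
      κ x s = (h s hs).mk _ x := by
    have : Countable S := hSc.to_subtype
    rw [ae_all_iff]
    intro s
    filter_upwards [(h s (hSm s s.2)).ae_eq_mk] with x hx hs using hx
  obtain ⟨M, hM, hMm, hM0⟩ := exists_measurable_superset_of_null (ae_iff.1 hae)
  have hMc : ∀ x, x ∉ M → ∀ s : S, ∀ hs : MeasurableSet (s : Set Y),
      κ x s = (h s hs).mk _ x := fun x hx => by
    by_contra hcon
    exact hx (hM hcon)
  let κ' : X → Measure Y := fun x => if x ∈ M then 0 else κ x
  have hfin' : ∀ x, IsFiniteMeasure (κ' x) := fun x => by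
    by_cases hx : x ∈ M
    · simp only [κ', if_pos hx]; infer_instance
    · simp only [κ', if_neg hx]; exact hfin x
  have key : ∀ s ∈ S, Measurable fun x => κ' x s := fun s hs => by
    have : (fun x => κ' x s) = fun x => if x ∈ M then 0 else (h s (hSm s hs)).mk _ x := by
      funext x
      by_cases hx : x ∈ M
      · simp [κ', hx]
      · simp only [κ', if_neg hx]
        exact hMc x hx ⟨s, hs⟩ (hSm s hs)
    rw [this]
    exact Measurable.ite hMm measurable_const (h s (hSm s hs)).measurable_mk
  refine ⟨κ', Measurable.measure_of_isPiSystem hSgen (fun s hs t ht _ => halg.inter_mem hs ht) key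
    (key _ halg.univ_mem), ?_⟩
  filter_upwards [measure_eq_zero_iff_ae_notMem.1 hM0] with x hx
  simp [κ', hx]

theorem aemeasurable_measure_sum {ι : Type*} [Countable ι] {ρ : Measure X}
    {κ : ι → X → Measure Y} (h : ∀ i, AEMeasurable (κ i) ρ) :
    AEMeasurable (fun x => Measure.sum fun i => κ i x) ρ := by
  refine ⟨fun x => Measure.sum fun i => (h i).mk _ x, ?_, ?_⟩
  · refine Measure.measurable_of_measurable_coe _ fun s hs => ?_
    simp_rw [Measure.sum_apply _ hs]
    exact Measurable.tsum fun i => (Measure.measurable_coe hs).comp (h i).measurable_mk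
  · have : ∀ᵐ x ∂ρ, ∀ i, κ i x = (h i).mk _ x := ae_all_iff.2 fun i => (h i).ae_eq_mk
    filter_upwards [this] with x hx
    simp only [hx]

end MeasureFamilies

/-! ### Weighted composition operators between `L²` spaces -/

section WeightedComposition

variable {Y Z : Type*} [MeasurableSpace Y] [MeasurableSpace Z] {ν : Measure Y} {l : Measure Z}
  {s : Z → Y} {w : Z → ℂ}

theorem ae_comp_of_map_withDensity (hs : Measurable s) (hw : AEStronglyMeasurable w l)
    (h : (l.withDensity fun z => ‖w z‖ₑ ^ 2).map s = ν) {P : Y → Prop} (hP : ∀ᵐ y ∂ν, P y) :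
    ∀ᵐ z ∂l, w z ≠ 0 → P (s z) := by
  rw [← h] at hP
  have h1 := ae_of_ae_map hs.aemeasurable hP
  rw [ae_withDensity_iff' (hw.enorm.pow_const 2)] at h1
  filter_upwards [h1] with z hz hwz
  exact hz (by simpa using hwz)

theorem lintegral_weighted_comp (hs : Measurable s) (hw : AEStronglyMeasurable w l)
    (h : (l.withDensity fun z => ‖w z‖ₑ ^ 2).map s = ν) {g : Y → ℂ} (hg : StronglyMeasurable g) :
    ∫⁻ z, ‖w z * g (s z)‖ₑ ^ 2 ∂l = ∫⁻ y, ‖g y‖ₑ ^ 2 ∂ν := by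
  have hgm : Measurable fun y => ‖g y‖ₑ ^ 2 := hg.measurable.enorm.pow_const 2
  rw [← h, lintegral_map hgm hs, lintegral_withDensity_eq_lintegral_mul₀ (hw.enorm.pow_const 2)
    (g := fun z => ‖g (s z)‖ₑ ^ 2) (hgm.comp hs).aemeasurable]
  refine lintegral_congr fun z => ?_
  simp [enorm_mul, mul_pow]

theorem eLpNorm_two_eq {f : Y → ℂ} : eLpNorm f 2 ν = (∫⁻ y, ‖f y‖ₑ ^ 2 ∂ν) ^ (1 / 2 : ℝ) := by
  rw [eLpNorm_eq_lintegral_rpow_enorm_toReal (by norm_num) (by norm_num)]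
  simp

/-- The source of all isometries below: the one onto `V₀`, the scaling operator, its inverse, and
the pieces `V k`. Any representative `g` is allowed, because a `ν`-null set pulls back to a set that
is null where `w ≠ 0`. -/
theorem exists_weightedComp (hs : Measurable s) (hw : AEStronglyMeasurable w l)
    (h : (l.withDensity fun z => ‖w z‖ₑ ^ 2).map s = ν) :
    ∃ V : Lp ℂ 2 ν →ₗᵢ[ℂ] Lp ℂ 2 l, ∀ (ξ : Lp ℂ 2 ν) (g : Y → ℂ), ξ =ᵐ[ν] g →
      V ξ =ᵐ[l] fun z => w z * g (s z) := by
  have hnorm : ∀ ξ : Lp ℂ 2 ν, eLpNorm (fun z => w z * ξ (s z)) 2 l = eLpNorm ξ 2 ν := fun ξ => by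
    rw [eLpNorm_two_eq, eLpNorm_two_eq, lintegral_weighted_comp hs hw h (Lp.stronglyMeasurable ξ)]
  have hmem : ∀ ξ : Lp ℂ 2 ν, MemLp (fun z => w z * ξ (s z)) 2 l := fun ξ =>
    ⟨hw.mul ((Lp.stronglyMeasurable ξ).comp_measurable hs).aestronglyMeasurable,
      by rw [hnorm]; exact Lp.eLpNorm_lt_top ξ⟩
  have hcongr : ∀ {g g' : Y → ℂ}, g =ᵐ[ν] g' →
      (fun z => w z * g (s z)) =ᵐ[l] fun z => w z * g' (s z) := fun {g g'} hg => by
    filter_upwards [ae_comp_of_map_withDensity hs hw h hg] with z hz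
    by_cases hwz : w z = 0
    · simp [hwz]
    · rw [hz hwz]
  let V : Lp ℂ 2 ν →ₗ[ℂ] Lp ℂ 2 l :=
    { toFun := fun ξ => (hmem ξ).toLp
      map_add' := fun ξ η => by
        refine Lp.ext ?_
        filter_upwards [(hmem (ξ + η)).coeFn_toLp, (hmem ξ).coeFn_toLp, (hmem η).coeFn_toLp,
          Lp.coeFn_add (hmem ξ).toLp (hmem η).toLp, hcongr (Lp.coeFn_add ξ η)]
          with z h1 h2 h3 h4 h5
        rw [h1, h4, Pi.add_apply, h2, h3, h5, Pi.add_apply, mul_add]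
      map_smul' := fun a ξ => by
        refine Lp.ext ?_
        filter_upwards [(hmem (a • ξ)).coeFn_toLp, (hmem ξ).coeFn_toLp,
          Lp.coeFn_smul a (hmem ξ).toLp, hcongr (Lp.coeFn_smul a ξ)] with z h1 h2 h3 h4
        rw [h1, RingHom.id_apply, h3, Pi.smul_apply, h2, h4, Pi.smul_apply, smul_eq_mul,
          smul_eq_mul]
        ring }
  refine ⟨⟨V, fun ξ => ?_⟩, fun ξ g hg => ?_⟩
  · change ‖(hmem ξ).toLp‖ = _
    rw [Lp.norm_toLp, hnorm, Lp.norm_def]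
  · exact (hmem ξ).coeFn_toLp.trans (hcongr hg)

end WeightedComposition

/-! ### Counting measures on the fibres -/

theorem fibreCard_pos {X : Type*} {r : X → X} (hr_surj : Function.Surjective r)
    (hr_fin : ∀ x, (r ⁻¹' {x}).Finite) (x : X) : 0 < fibreCard r x :=
  (Set.ncard_pos (hr_fin x)).2 (hr_surj x)

theorem finsum_fibre_indicator {X : Type*} (q : X → X) (hq : ∀ x, (q ⁻¹' {x}).Finite) (x : X) (s : Set X) :
    ∑ᶠ y ∈ q ⁻¹' {x}, s.indicator (fun _ => (1 : ℂ)) y = ((q ⁻¹' {x} ∩ s).ncard : ℂ) := by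
  rw [finsum_mem_def, Set.indicator_indicator, ← finsum_mem_def,
    finsum_mem_eq_finite_toFinset_sum _ ((hq x).inter_of_left s), Finset.sum_const,
    Set.ncard_eq_toFinset_card _ ((hq x).inter_of_left s)]
  simp

section Fibres

variable {X : Type*} [MeasurableSpace X]

/-- The counting measure on the fibre `q⁻¹(x)`. -/
def fibreMeasure (q : X → X) (x : X) : Measure X :=
  Measure.sum fun y : q ⁻¹' {x} => Measure.dirac (y : X)

theorem lintegral_fibreMeasure [MeasurableSingletonClass X] (q : X → X) (x : X) (f : X → ℝ≥0∞) :
    ∫⁻ y, f y ∂(fibreMeasure q x) = ∑' y : q ⁻¹' {x}, f y := by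
  simp [fibreMeasure, lintegral_sum_measure, lintegral_dirac]

theorem fibreMeasure_apply (q : X → X) (x : X) {s : Set X} (hs : MeasurableSet s) :
    fibreMeasure q x s = ((q ⁻¹' {x} ∩ s).encard : ℝ≥0∞) := by
  rw [fibreMeasure, Measure.sum_apply _ hs]
  simp_rw [Measure.dirac_apply' _ hs]
  rw [tsum_subtype (q ⁻¹' {x}) (s.indicator 1), Set.indicator_indicator, ← tsum_subtype]
  exact ENNReal.tsum_set_one _

/-- The fibres of `q` are finite, summation over them preserves a.e. measurability, and
`∫ ∑_{q(y) = x} f(y) dρ(x) = ∫ D f dρ`. -/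
structure FibreRegular (ρ : Measure X) (q : X → X) (D : X → ℝ≥0∞) : Prop where
  measurable : Measurable q
  finite : ∀ x, (q ⁻¹' {x}).Finite
  aemeasurable_fibreMeasure : AEMeasurable (fibreMeasure q) ρ
  weight_ne_zero : ∀ x, D x ≠ 0
  weight_ne_top : ∀ x, D x ≠ ∞
  aemeasurable_weight : AEMeasurable D ρ
  bind_eq : ρ.bind (fibreMeasure q) = ρ.withDensity D

namespace FibreRegular

variable {ρ : Measure X} {q : X → X} {D : X → ℝ≥0∞}

theorem ae_bind (h : FibreRegular ρ q D) {P : X → Prop} (hP : ∀ᵐ x ∂ρ, P x) :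
    ∀ᵐ x ∂(ρ.bind (fibreMeasure q)), P x := by
  rw [h.bind_eq]
  exact (withDensity_absolutelyContinuous ρ D).ae_le hP

/-- The measure obtained by summing over fibres is `D ρ ≪ ρ`, so a null set meets the fibres over
almost no points. -/
theorem ae_fibre [MeasurableSingletonClass X] (h : FibreRegular ρ q D) {P : X → Prop}
    (hP : ∀ᵐ x ∂ρ, P x) : ∀ᵐ x ∂ρ, ∀ y, q y = x → P y := by
  filter_upwards [Measure.ae_ae_of_ae_bind h.aemeasurable_fibreMeasure (h.ae_bind hP)]
    with x hx y hy
  have : Countable (q ⁻¹' {x}) := (h.finite x).countable.to_subtype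
  have := Measure.ae_sum_iff.1 hx ⟨y, hy⟩
  rwa [ae_dirac_eq] at this

theorem aemeasurable_bind (h : FibreRegular ρ q D) {β : Type*} [MeasurableSpace β] {f : X → β}
    (hf : AEMeasurable f ρ) : AEMeasurable f (ρ.bind (fibreMeasure q)) := by
  rw [h.bind_eq]
  exact hf.mono_ac (withDensity_absolutelyContinuous ρ D)

theorem lintegral_fibre (h : FibreRegular ρ q D) {f : X → ℝ≥0∞} (hf : AEMeasurable f ρ) :
    ∫⁻ x, ∫⁻ y, f y ∂(fibreMeasure q x) ∂ρ = ∫⁻ x, D x * f x ∂ρ := by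
  rw [← Measure.lintegral_bind h.aemeasurable_fibreMeasure (h.aemeasurable_bind hf), h.bind_eq,
    lintegral_withDensity_eq_lintegral_mul₀ h.aemeasurable_weight hf]
  rfl

theorem aemeasurable_fibre (h : FibreRegular ρ q D) {f : X → ℝ≥0∞} (hf : AEMeasurable f ρ) :
    AEMeasurable (fun x => ∫⁻ y, f y ∂(fibreMeasure q x)) ρ :=
  (Measure.aemeasurable_lintegral (h.aemeasurable_bind hf)).comp_aemeasurable
    h.aemeasurable_fibreMeasure

/-- For null `s`, almost every fibre misses `q⁻¹(s)`, so `D ρ` vanishes on it; as `D` has no zeros,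
so does `ρ`. -/
theorem quasiMeasurePreserving [MeasurableSingletonClass X] (h : FibreRegular ρ q D) :
    Measure.QuasiMeasurePreserving q ρ ρ := by
  refine ⟨h.measurable, Measure.AbsolutelyContinuous.mk fun s hs h0 => ?_⟩
  rw [Measure.map_apply h.measurable hs]
  have h1 : ρ.withDensity D (q ⁻¹' s) = 0 := by
    rw [← h.bind_eq, Measure.bind_apply (h.measurable hs) h.aemeasurable_fibreMeasure]
    refine (lintegral_eq_zero_of_ae_eq_zero ?_)
    filter_upwards [measure_eq_zero_iff_ae_notMem.1 h0] with x hx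
    rw [fibreMeasure_apply _ _ (h.measurable hs)]
    have : q ⁻¹' {x} ∩ q ⁻¹' s = ∅ := by
      ext y
      simp only [Set.mem_inter_iff, Set.mem_preimage, Set.mem_singleton_iff,
        Set.mem_empty_iff_false, iff_false, not_and]
      rintro rfl
      exact hx
    simp [this]
  rw [withDensity_apply_eq_zero' h.aemeasurable_weight] at h1
  have : {x | D x ≠ 0} ∩ q ⁻¹' s = q ⁻¹' s := by
    ext x; simp [h.weight_ne_zero x]
  rwa [this] at h1

theorem id [MeasurableSingletonClass X] (ρ : Measure X) : FibreRegular ρ (fun x => x) 1 := by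
  have hd : fibreMeasure (fun x : X => x) = Measure.dirac := by
    funext x
    ext s hs
    rw [fibreMeasure_apply _ _ hs, Measure.dirac_apply' _ hs]
    by_cases hx : x ∈ s
    · have : (fun x : X => x) ⁻¹' {x} ∩ s = {x} := by
        ext y; simp only [Set.mem_inter_iff, Set.mem_preimage, Set.mem_singleton_iff]
        exact ⟨fun h => h.1, fun h => ⟨h, h ▸ hx⟩⟩
      simp [hx]
    · have : (fun x : X => x) ⁻¹' {x} ∩ s = ∅ := by
        ext y; simp only [Set.mem_inter_iff, Set.mem_preimage, Set.mem_singleton_iff,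
          Set.mem_empty_iff_false, iff_false, not_and]
        rintro rfl; exact hx
      simp [hx]
  refine ⟨measurable_id, fun x => Set.finite_singleton x, ?_, fun x => one_ne_zero,
    fun x => ENNReal.one_ne_top, measurable_one.aemeasurable, ?_⟩
  · rw [hd]; exact Measure.measurable_dirac.aemeasurable
  · rw [hd, Measure.bind_dirac, withDensity_one]

theorem lintegral_fibreMeasure_comp [MeasurableSingletonClass X] (q q' : X → X) (x : X)
    (f : X → ℝ≥0∞) : ∫⁻ y, f y ∂(fibreMeasure (q ∘ q') x) =
      ∫⁻ y, ∫⁻ z, f z ∂(fibreMeasure q' y) ∂(fibreMeasure q x) := by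
  simp_rw [lintegral_fibreMeasure]
  rw [← ENNReal.tsum_sigma' (fun a : (Σ y : q ⁻¹' {x}, q' ⁻¹' {(y : X)}) => f a.2)]
  let e : (Σ y : q ⁻¹' {x}, q' ⁻¹' {(y : X)}) ≃ (q ∘ q') ⁻¹' {x} :=
    { toFun := fun a => ⟨a.2, by
        have h1 : q' a.2 = a.1 := a.2.2
        have h2 : q a.1 = x := a.1.2
        simp [h1, h2]⟩
      invFun := fun z => ⟨⟨q' z, z.2⟩, ⟨z, rfl⟩⟩
      left_inv := by
        rintro ⟨⟨y, hy⟩, ⟨z, hz⟩⟩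
        have hz' : q' z = y := hz
        subst hz'
        rfl
      right_inv := fun z => rfl }
  exact (e.tsum_eq (fun z : (q ∘ q') ⁻¹' {x} => f z)).symm

theorem comp [MeasurableSingletonClass X] [MeasurableSpace.CountablyGenerated X]
    {q' : X → X} {D' : X → ℝ≥0∞} (h : FibreRegular ρ q D)
    (h' : FibreRegular ρ q' D') : FibreRegular ρ (q ∘ q') fun x => D' x * D (q' x) := by
  have hfin : ∀ x, ((q ∘ q') ⁻¹' {x}).Finite := fun x => by
    rw [Set.preimage_comp]
    exact (h.finite x).preimage' fun b _ => h'.finite b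
  have hap : ∀ s, MeasurableSet s → ∀ x, fibreMeasure (q ∘ q') x s =
      ∫⁻ y, fibreMeasure q' y s ∂(fibreMeasure q x) := fun s hs x => by
    rw [← lintegral_indicator_one hs, lintegral_fibreMeasure_comp]
    simp_rw [lintegral_indicator_one hs]
  have hms : ∀ s, MeasurableSet s → AEMeasurable (fun y => fibreMeasure q' y s) ρ := fun s hs =>
    (Measure.measurable_coe hs).comp_aemeasurable h'.aemeasurable_fibreMeasure
  have hae : AEMeasurable (fibreMeasure (q ∘ q')) ρ := by
    refine aemeasurable_measure_of_apply (fun x => ⟨?_⟩) fun s hs => ?_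
    · rw [fibreMeasure_apply _ _ MeasurableSet.univ, Set.inter_univ]
      simpa using hfin x
    · simp_rw [hap s hs]
      exact h.aemeasurable_fibre (hms s hs)
  have hDq : AEMeasurable (fun x => D (q' x)) ρ :=
    h.aemeasurable_weight.comp_quasiMeasurePreserving h'.quasiMeasurePreserving
  have hW : AEMeasurable (fun x => D' x * D (q' x)) ρ := h'.aemeasurable_weight.mul hDq
  refine ⟨h.measurable.comp h'.measurable, hfin, hae,
    fun x => mul_ne_zero (h'.weight_ne_zero x) (h.weight_ne_zero _),
    fun x => ENNReal.mul_ne_top (h'.weight_ne_top x) (h.weight_ne_top _), hW, ?_⟩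
  ext s hs
  rw [Measure.bind_apply hs hae]
  simp_rw [hap s hs]
  rw [h.lintegral_fibre (hms s hs), withDensity_apply _ hs, ← lintegral_indicator hs]
  -- The factor `D x` moves under the sum over `q'⁻¹(x)` as `D (q' y)`; this produces the product
  -- weight.
  have h1 : ∀ x, D x * fibreMeasure q' x s =
      ∫⁻ y, s.indicator (fun y => D (q' y)) y ∂(fibreMeasure q' x) := fun x => by
    rw [← lintegral_indicator_one hs, lintegral_fibreMeasure, lintegral_fibreMeasure,
      ← ENNReal.tsum_mul_left]
    refine tsum_congr fun y => ?_
    have hy : q' y = x := y.2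
    by_cases hys : (y : X) ∈ s <;> simp [hys, hy]
  simp_rw [h1]
  rw [h'.lintegral_fibre (hDq.indicator hs)]
  refine lintegral_congr fun x => ?_
  by_cases hx : x ∈ s <;> simp [hx]

theorem iterate [MeasurableSingletonClass X] [MeasurableSpace.CountablyGenerated X]
    (h : FibreRegular ρ q D) (n : ℕ) : ∃ D', FibreRegular ρ q^[n] D' := by
  induction n with
  | zero => exact ⟨1, FibreRegular.id ρ⟩
  | succ n ih =>
    obtain ⟨D', hD'⟩ := ih
    rw [Function.iterate_succ]
    exact ⟨_, hD'.comp h⟩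

end FibreRegular

theorem memLp_top_indicator_one {ρ : Measure X} [IsFiniteMeasure ρ] {s : Set X}
    (hs : MeasurableSet s) : MemLp (s.indicator fun _ => (1 : ℂ)) ∞ ρ :=
  memLp_indicator_const _ hs _ (Or.inr (measure_ne_top ρ s))

/-- The averages over the fibres are a.e. measurable, for otherwise the averages of the indicators
of `s` and of its complement would both have integral `0`. -/
theorem StronglyInvariant.aemeasurable_average {ρ : Measure X} [IsProbabilityMeasure ρ] {r : X → X}
    (hr_surj : Function.Surjective r) (hr_fin : ∀ x, (r ⁻¹' {x}).Finite)
    (hρ : StronglyInvariant r ρ) {s : Set X} (hs : MeasurableSet s) :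
    AEMeasurable (fun x => (fibreCard r x : ℝ≥0∞)⁻¹ * fibreMeasure r x s) ρ ∧
      ∫⁻ x, (fibreCard r x : ℝ≥0∞)⁻¹ * fibreMeasure r x s ∂ρ = ρ s := by
  have hpos : ∀ x, 0 < fibreCard r x := fun x => (Set.ncard_pos (hr_fin x)).2 (hr_surj x)
  let g : Set X → X → ℝ := fun s x => (fibreCard r x : ℝ)⁻¹ * ((r ⁻¹' {x} ∩ s).ncard : ℝ)
  have hg0 : ∀ s x, 0 ≤ g s x := fun s x => by positivity
  have hgsum : ∀ s x, g s x + g sᶜ x = 1 := fun s x => by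
    have h1 : ((r ⁻¹' {x} ∩ s).ncard : ℝ) + ((r ⁻¹' {x} ∩ sᶜ).ncard : ℝ) = fibreCard r x := by
      rw [← Set.sdiff_eq]
      exact_mod_cast Set.ncard_inter_add_ncard_sdiff_eq_ncard (r ⁻¹' {x}) s (hr_fin x)
    have h2 : (fibreCard r x : ℝ) ≠ 0 := by exact_mod_cast (hpos x).ne'
    simp only [g]
    rw [← mul_add, h1, inv_mul_cancel₀ h2]
  have hg1 : ∀ s x, g s x ≤ 1 := fun s x => by linarith [hgsum s x, hg0 sᶜ x]
  have hint : ∀ s, MeasurableSet s → ∫ x, g s x ∂ρ = ρ.real s := fun s hs => by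
    have h1 := hρ _ (memLp_top_indicator_one hs)
    simp_rw [finsum_fibre_indicator r hr_fin] at h1
    rw [integral_indicator_const _ hs] at h1
    have h2 : (fun x => 1 / (fibreCard r x : ℂ) * ((r ⁻¹' {x} ∩ s).ncard : ℂ)) =
        fun x => ((g s x : ℝ) : ℂ) := by
      funext x; simp [g]
    rw [h2, integral_complex_ofReal] at h1
    have h3 : ((ρ.real s : ℝ) : ℂ) = ((∫ x, g s x ∂ρ : ℝ) : ℂ) := by
      rw [← h1]; simp
    exact_mod_cast h3.symm
  -- The Bochner integral of a non-integrable function is `0` by convention. Were `g s` not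
  -- integrable, neither would be `g sᶜ`, and `ρ(s) + ρ(sᶜ)` would be `0`.
  have hi : Integrable (g s) ρ := by
    by_contra hni
    have hnc : ¬ Integrable (g sᶜ) ρ := fun hc => hni <| by
      have : g s = fun x => 1 - g sᶜ x := by
        funext x; linarith [hgsum s x]
      rw [this]
      exact (integrable_const 1).sub hc
    have h1 := hint s hs
    have h2 := hint sᶜ hs.compl
    rw [integral_undef hni] at h1
    rw [integral_undef hnc] at h2
    have := probReal_add_probReal_compl (μ := ρ) hs
    linarith
  have hG : (fun x => (fibreCard r x : ℝ≥0∞)⁻¹ * fibreMeasure r x s) =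
      fun x => ENNReal.ofReal (g s x) := by
    funext x
    rw [fibreMeasure_apply _ _ hs, ENNReal.ofReal_mul (by positivity),
      ENNReal.ofReal_inv_of_pos (by exact_mod_cast hpos x), ENNReal.ofReal_natCast,
      ENNReal.ofReal_natCast, ← ((hr_fin x).inter_of_left s).cast_ncard_eq]
    rfl
  rw [hG]
  refine ⟨hi.aestronglyMeasurable.aemeasurable.ennreal_ofReal, ?_⟩
  rw [← ofReal_integral_eq_lintegral_ofReal hi (Eventually.of_forall (hg0 s)), hint s hs]
  exact ofReal_measureReal

/-- The average of an indicator over the fibre is a multiple of `1 / #r⁻¹(x)`, and a basic open set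
isolating one point of the finite fibre attains exactly this value. Zero averages are replaced by
`∞`. The countable infimum transfers a.e. measurability from the averages to the cardinality. -/
theorem fibreCard_inv_eq_iInf [TopologicalSpace X] [T1Space X] [SecondCountableTopology X]
    [OpensMeasurableSpace X] {r : X → X} (hr_surj : Function.Surjective r)
    (hr_fin : ∀ x, (r ⁻¹' {x}).Finite) (x : X) :
    (fibreCard r x : ℝ≥0∞)⁻¹ = ⨅ s : TopologicalSpace.countableBasis X,
      if (fibreCard r x : ℝ≥0∞)⁻¹ * fibreMeasure r x s = 0 then ∞
        else (fibreCard r x : ℝ≥0∞)⁻¹ * fibreMeasure r x s := by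
  have hb := TopologicalSpace.isBasis_countableBasis X
  have hm : ∀ s : TopologicalSpace.countableBasis X, MeasurableSet (s : Set X) := fun s =>
    (hb.isOpen s.2).measurableSet
  refine le_antisymm (le_iInf fun s => ?_) ?_
  · split_ifs with h
    · exact le_top
    · rw [fibreMeasure_apply _ _ (hm s)] at h ⊢
      have h1 : (1 : ℝ≥0∞) ≤ ((r ⁻¹' {x} ∩ s).encard : ℝ≥0∞) := by
        have h2 : (r ⁻¹' {x} ∩ s).encard ≠ 0 := fun h0 => h (by simp [h0])
        have h3 := Order.one_le_iff_ne_zero.2 h2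
        exact_mod_cast h3
      calc (fibreCard r x : ℝ≥0∞)⁻¹ = (fibreCard r x : ℝ≥0∞)⁻¹ * 1 := (mul_one _).symm
        _ ≤ _ := by gcongr
  · obtain ⟨y, hy⟩ := hr_surj x
    obtain ⟨s, hs, hys, hsub⟩ := hb.exists_subset_of_mem_open (u := ((r ⁻¹' {x}) \ {y})ᶜ)
      (a := y) (by simp) ((hr_fin x).subset Set.sdiff_subset).isClosed.isOpen_compl
    refine (iInf_le _ ⟨s, hs⟩).trans ?_
    have h1 : r ⁻¹' {x} ∩ s = {y} := by
      ext z
      simp only [Set.mem_inter_iff, Set.mem_preimage, Set.mem_singleton_iff]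
      constructor
      · rintro ⟨hz, hzs⟩
        by_contra hne
        exact hsub hzs ⟨hz, hne⟩
      · rintro rfl
        exact ⟨hy, hys⟩
    rw [fibreMeasure_apply _ _ (hm ⟨s, hs⟩)]
    simp only [h1, Set.encard_singleton]
    split_ifs with h
    · simp at h
    · simp

theorem StronglyInvariant.fibreRegular [TopologicalSpace X] [T1Space X] [SecondCountableTopology X]
    [BorelSpace X] {ρ : Measure X} [IsProbabilityMeasure ρ] {r : X → X}
    (hr : Measurable r) (hr_surj : Function.Surjective r) (hr_fin : ∀ x, (r ⁻¹' {x}).Finite)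
    (hρ : StronglyInvariant r ρ) :
    FibreRegular ρ r fun x => (fibreCard r (r x) : ℝ≥0∞) := by
  have hpos := fibreCard_pos hr_surj hr_fin
  have hav := fun {s : Set X} (hs : MeasurableSet s) =>
    hρ.aemeasurable_average hr_surj hr_fin hs
  have hinv : AEMeasurable (fun x => (fibreCard r x : ℝ≥0∞)⁻¹) ρ := by
    refine AEMeasurable.congr ?_
      (Eventually.of_forall fun x => (fibreCard_inv_eq_iInf hr_surj hr_fin x).symm)
    have : Countable (TopologicalSpace.countableBasis X) :=
      (TopologicalSpace.countable_countableBasis X).to_subtype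
    refine AEMeasurable.iInf fun s => ?_
    have hφ : Measurable fun t : ℝ≥0∞ => if t = 0 then ∞ else t :=
      Measurable.ite (measurableSet_singleton 0) measurable_const measurable_id
    exact hφ.comp_aemeasurable (hav ((TopologicalSpace.isBasis_countableBasis X).isOpen
      s.2).measurableSet).1
  have hcard : AEMeasurable (fun x => (fibreCard r x : ℝ≥0∞)) ρ :=
    hinv.inv.congr (Eventually.of_forall fun x => inv_inv _)
  have hne : ∀ x, (fibreCard r x : ℝ≥0∞) ≠ 0 := fun x => by exact_mod_cast (hpos x).ne'
  have hnt : ∀ x, (fibreCard r x : ℝ≥0∞) ≠ ∞ := fun x => ENNReal.natCast_ne_top _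
  have hset : ∀ s, MeasurableSet s → AEMeasurable (fun x => fibreMeasure r x s) ρ := fun s hs => by
    have := hcard.mul (hav hs).1
    refine this.congr (Eventually.of_forall fun x => ?_)
    simp only [Pi.mul_apply]
    rw [← mul_assoc, ENNReal.mul_inv_cancel (hne x) (hnt x), one_mul]
  have hfinm : ∀ x, IsFiniteMeasure (fibreMeasure r x) := fun x => ⟨by
    rw [fibreMeasure_apply _ _ MeasurableSet.univ, Set.inter_univ]
    simpa using hr_fin x⟩
  have hae : AEMeasurable (fibreMeasure r) ρ := aemeasurable_measure_of_apply hfinm hset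
  have hqmp : Measure.QuasiMeasurePreserving r ρ ρ := by
    refine ⟨hr, Measure.AbsolutelyContinuous.mk fun s hs h0 => ?_⟩
    rw [Measure.map_apply hr hs, ← (hav (hr hs)).2]
    refine lintegral_eq_zero_of_ae_eq_zero ?_
    filter_upwards [measure_eq_zero_iff_ae_notMem.1 h0] with x hx
    rw [fibreMeasure_apply _ _ (hr hs)]
    have : r ⁻¹' {x} ∩ r ⁻¹' s = ∅ := by
      ext y
      simp only [Set.mem_inter_iff, Set.mem_preimage, Set.mem_singleton_iff,
        Set.mem_empty_iff_false, iff_false, not_and]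
      rintro rfl
      exact hx
    simp [this]
  have hD : AEMeasurable (fun x => (fibreCard r (r x) : ℝ≥0∞)) ρ :=
    hcard.comp_quasiMeasurePreserving hqmp
  -- Strong invariance says that `ρ` is invariant under the normalized fibre measures `τ`. Testing
  -- this on `#r⁻¹(r(y))`, which is constant on each fibre, undoes the normalization.
  let τ : X → Measure X := fun x => (fibreCard r x : ℝ≥0∞)⁻¹ • fibreMeasure r x
  have hτ : AEMeasurable τ ρ := by
    refine aemeasurable_measure_of_apply (fun x => ?_) fun s hs => (hav hs).1
    have := hfinm x
    exact Measure.smul_finite _ (ENNReal.inv_ne_top.2 (hne x))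
  have hτb : ρ.bind τ = ρ := by
    ext s hs
    rw [Measure.bind_apply hs hτ]
    exact (hav hs).2
  refine ⟨hr, hr_fin, hae, fun x => hne _, fun x => hnt _, hD, ?_⟩
  ext s hs
  rw [Measure.bind_apply hs hae, withDensity_apply _ hs, ← lintegral_indicator hs]
  have hf : AEMeasurable (s.indicator fun x => (fibreCard r (r x) : ℝ≥0∞)) (ρ.bind τ) := by
    rw [hτb]; exact hD.indicator hs
  conv_rhs => rw [← hτb]
  rw [Measure.lintegral_bind hτ hf]
  refine lintegral_congr fun x => ?_
  simp only [τ]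
  rw [lintegral_smul_measure, lintegral_fibreMeasure, ← lintegral_indicator_one hs,
    lintegral_fibreMeasure, smul_eq_mul, ← ENNReal.tsum_mul_left]
  refine tsum_congr fun y => ?_
  have hy : r y = x := y.2
  by_cases hys : (y : X) ∈ s
  · simp [hys, hy, ENNReal.inv_mul_cancel (hne x) (hnt x)]
  · simp [hys]

end Fibres

/-! ### Uniqueness of the multiplicity function -/

section Uniqueness

variable {X : Type*} [MeasurableSpace X]

theorem integral_restrict_indicator_of_subset {ρ : Measure X} {B S : Set X} (hB : MeasurableSet B)
    (hBS : B ⊆ S) (h : X → ℂ) : ∫ x, B.indicator h x ∂(ρ.restrict S) = ∫ x in B, h x ∂ρ := by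
  rw [integral_indicator hB, Measure.restrict_restrict hB, Set.inter_eq_left.2 hBS]

/-- The indicators of `A` in the first `m + 1` summands of the first model become, in the second
model, `m + 1` families of functions with only `m` components over `A`. They are orthonormal at
almost every point of `A`, which is impossible in `ℂ^m` unless `A` is null. -/
theorem IsMultiplicityFunction.measure_eq_zero {ρ : Measure X} [IsFiniteMeasure ρ] {H : Type*}
    [NormedAddCommGroup H] [InnerProductSpace ℂ H] {π : Lp ℂ ∞ ρ → H →L[ℂ] H} {d d' : X → ℕ∞}
    (hd : IsMultiplicityFunction ρ π d) (hd' : IsMultiplicityFunction ρ π d') {A : Set X}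
    (hA : MeasurableSet A) (m : ℕ) (hAd : ∀ x ∈ A, ((m + 1 : ℕ) : ℕ∞) ≤ d x)
    (hAd' : ∀ x ∈ A, d' x = m) : ρ A = 0 := by
  obtain ⟨-, J, hJ⟩ := hd
  obtain ⟨-, J', hJ'⟩ := hd'
  let S : ℕ → Set X := fun k => {x | (k : ℕ∞) + 1 ≤ d x}
  let S' : ℕ → Set X := fun k => {x | (k : ℕ∞) + 1 ≤ d' x}
  let u : ∀ k, Lp ℂ 2 (ρ.restrict (S k)) := fun k =>
    indicatorConstLp 2 hA (measure_ne_top _ _) (1 : ℂ)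
  let e : ℕ → H := fun i => J.symm (lp.single 2 i (u i))
  let v : ∀ i k, Lp ℂ 2 (ρ.restrict (S' k)) := fun i k => J' (e i) k
  have hAS : ∀ k < m + 1, A ⊆ S k := fun k hk x hx => by
    refine le_trans ?_ (hAd x hx)
    exact_mod_cast hk
  have hAS' : ∀ k < m, A ⊆ S' k := fun k hk x hx => by
    change (k : ℕ∞) + 1 ≤ d' x
    rw [hAd' x hx]
    exact_mod_cast hk
  have hAS'' : ∀ k, m ≤ k → ∀ x ∈ S' k, x ∉ A := fun k hk x hx hxA => by
    have h1 : (k : ℕ∞) + 1 ≤ d' x := hx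
    rw [hAd' x hxA] at h1
    have h2 : k + 1 ≤ m := by exact_mod_cast h1
    omega
  have hv : ∀ k < m, ∀ i, MemLp (v i k) 2 (ρ.restrict A) := fun k hk i =>
    (Lp.memLp (v i k)).mono_measure (Measure.restrict_mono (hAS' k hk) le_rfl)
  -- Both models compute `⟨π(1_B) e_i, e_j⟩`. Letting `B` vary localizes orthonormality to points.
  have key : ∀ B, MeasurableSet B → B ⊆ A → ∀ i < m + 1, ∀ j < m + 1,
      ∑ k ∈ Finset.range m, ∫ x in B, v j k x * (starRingEnd ℂ) (v i k x) ∂ρ =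
        if i = j then (ρ.real B : ℂ) else 0 := by
    intro B hB hBA i hi j hj
    let f : Lp ℂ ∞ ρ := indicatorConstLp ∞ hB (measure_ne_top _ _) (1 : ℂ)
    have hf : ∀ S : Set X, f =ᵐ[ρ.restrict S] B.indicator fun _ => (1 : ℂ) := fun S =>
      ae_restrict_of_ae indicatorConstLp_coeFn
    have h1 : inner ℂ (J (π f (e i))) (J (e j)) = if i = j then (ρ.real B : ℂ) else 0 := by
      have h2 : J (e j) = lp.single 2 j (u j) := J.apply_symm_apply _
      have h3 : J (e i) = lp.single 2 i (u i) := J.apply_symm_apply _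
      rw [h2, lp.inner_single_right, L2.inner_def]
      have h4 := hJ f (e i) j
      rw [h3] at h4
      by_cases hij : i = j
      · subst hij
        rw [lp.single_apply_self] at h4
        have h5 : ∀ᵐ x ∂(ρ.restrict (S i)),
            inner ℂ (J (π f (e i)) i x) (u i x) = B.indicator (fun _ => (1 : ℂ)) x := by
          filter_upwards [h4, hf (S i), (indicatorConstLp_coeFn : u i =ᵐ[_] _)] with x h5 h6 h7
          rw [h5, h6, h7]
          by_cases hx : x ∈ B
          · simp [hx, hBA hx]
          · simp [hx]
        rw [integral_congr_ae h5, integral_restrict_indicator_of_subset hB (hBA.trans (hAS i hi))]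
        simp
      · rw [lp.single_apply_ne _ _ _ (Ne.symm hij)] at h4
        have h5 : ∀ᵐ x ∂(ρ.restrict (S j)), inner ℂ (J (π f (e i)) j x) (u j x) = 0 := by
          filter_upwards [h4, Lp.coeFn_zero ℂ 2 (ρ.restrict (S j))] with x h5 h6
          rw [h5, h6]
          simp
        rw [integral_congr_ae h5, if_neg hij, integral_zero]
    rw [LinearIsometryEquiv.inner_map_map, ← J'.inner_map_map, lp.inner_eq_tsum] at h1
    rw [← h1, tsum_eq_sum (s := Finset.range m)]
    · refine Finset.sum_congr rfl fun k hk => ?_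
      rw [L2.inner_def, ← integral_restrict_indicator_of_subset hB
        (hBA.trans (hAS' k (Finset.mem_range.1 hk)))]
      refine integral_congr_ae ?_
      filter_upwards [hJ' f (e i) k, hf (S' k)] with x h5 h6
      rw [h5, h6]
      by_cases hx : x ∈ B
      · simp [hx, v]
      · simp [hx]
    -- For `k ≥ m` the domain of the `k`-th summand misses `A`, since `d' = m` there.
    · intro k hk
      rw [L2.inner_def]
      refine integral_eq_zero_of_ae ?_
      have hmem : ∀ᵐ x ∂(ρ.restrict (S' k)), x ∉ B := by
        rw [ae_iff]
        simp only [not_not, Set.ofPred_mem_eq]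
        rw [Measure.restrict_apply hB]
        convert measure_empty (μ := ρ)
        ext x
        simp only [Set.mem_inter_iff, Set.mem_empty_iff_false, iff_false, not_and]
        exact fun hx hxS => hAS'' k (by simpa using hk) x hxS (hBA hx)
      filter_upwards [hJ' f (e i) k, hf (S' k), hmem] with x h5 h6 h7
      rw [h5, h6]
      simp [h7]
  have hint : ∀ i j, ∀ k ∈ Finset.range m,
      Integrable (fun x => v j k x * (starRingEnd ℂ) (v i k x)) (ρ.restrict A) :=
    fun i j k hk => (hv k (Finset.mem_range.1 hk) j).integrable_mul
      (hv k (Finset.mem_range.1 hk) i).star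
  have hortho : ∀ i < m + 1, ∀ j < m + 1, ∀ᵐ x ∂(ρ.restrict A),
      ∑ k ∈ Finset.range m, v j k x * (starRingEnd ℂ) (v i k x) = if i = j then 1 else 0 := by
    intro i hi j hj
    refine Integrable.ae_eq_of_forall_setIntegral_eq _ _ (integrable_finsetSum _ (hint i j))
      (integrable_const _) fun s hs _ => ?_
    rw [integral_finsetSum _ fun k hk => (hint i j k hk).restrict, Measure.restrict_restrict hs,
      key (s ∩ A) (hs.inter hA) Set.inter_subset_right i hi j hj]
    split_ifs <;> simp
  by_contra hne
  have hall : ∀ᵐ x ∂(ρ.restrict A), ∀ i j : Fin (m + 1),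
      ∑ k ∈ Finset.range m, v j k x * (starRingEnd ℂ) (v i k x) =
        if (i : ℕ) = j then 1 else 0 := by
    rw [ae_all_iff]; intro i
    rw [ae_all_iff]; intro j
    exact hortho i i.2 j j.2
  have : (ae (ρ.restrict A)).NeBot := by
    rw [ae_neBot]
    intro h0
    exact hne (Measure.restrict_eq_zero.1 h0)
  obtain ⟨x, hx⟩ := hall.exists
  let w : Fin (m + 1) → EuclideanSpace ℂ (Fin m) := fun i => WithLp.toLp 2 fun k => v i k x
  have hw : Orthonormal ℂ w := by
    rw [orthonormal_iff_ite]
    intro i j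
    rw [PiLp.inner_apply]
    have := hx i j
    rw [← Fin.sum_univ_eq_sum_range (fun k => v j k x * (starRingEnd ℂ) (v i k x))] at this
    simpa [w, Fin.ext_iff] using this
  have := hw.linearIndependent.fintype_card_le_finrank
  simp at this

theorem IsMultiplicityFunction.ae_le {ρ : Measure X} [IsFiniteMeasure ρ] {H : Type*}
    [NormedAddCommGroup H] [InnerProductSpace ℂ H] {π : Lp ℂ ∞ ρ → H →L[ℂ] H} {d d' : X → ℕ∞}
    (hd : IsMultiplicityFunction ρ π d) (hd' : IsMultiplicityFunction ρ π d') :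
    ∀ᵐ x ∂ρ, d x ≤ d' x := by
  have h1 : ∀ m : ℕ, ∀ᵐ x ∂ρ, ¬ (((m + 1 : ℕ) : ℕ∞) ≤ d x ∧ d' x = m) := fun m => by
    have hm : NullMeasurableSet (d ⁻¹' Set.Ici ((m + 1 : ℕ) : ℕ∞) ∩ d' ⁻¹' {(m : ℕ∞)}) ρ :=
      (hd.1.nullMeasurable (Set.to_countable _).measurableSet).inter
        (hd'.1.nullMeasurable (Set.to_countable _).measurableSet)
    obtain ⟨A, hsub, hA, hAe⟩ := hm.exists_measurable_subset_ae_eq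
    have h0 : ρ A = 0 := hd.measure_eq_zero hd' hA m (fun x hx => (hsub hx).1)
      fun x hx => (hsub hx).2
    rw [measure_congr hAe] at h0
    exact measure_eq_zero_iff_ae_notMem.1 h0
  filter_upwards [ae_all_iff.2 h1] with x hx
  by_contra hlt
  rw [not_le] at hlt
  -- Where `d' < d`, the value of `d'` is finite, so countably many exceptional sets suffice.
  obtain ⟨m, hm⟩ := ENat.ne_top_iff_exists.1 (ne_top_of_lt hlt)
  refine hx m ⟨?_, hm.symm⟩
  rw [← hm] at hlt
  push_cast
  exact Order.add_one_le_of_lt hlt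

theorem IsMultiplicityFunction.ae_eq {ρ : Measure X} [IsFiniteMeasure ρ] {H : Type*}
    [NormedAddCommGroup H] [InnerProductSpace ℂ H] {π : Lp ℂ ∞ ρ → H →L[ℂ] H} {d d' : X → ℕ∞}
    (hd : IsMultiplicityFunction ρ π d) (hd' : IsMultiplicityFunction ρ π d') :
    ∀ᵐ x ∂ρ, d x = d' x := by
  filter_upwards [hd.ae_le hd', hd'.ae_le hd] with x h1 h2 using le_antisymm h1 h2

end Uniqueness

/-! ### Ranks inside the fibres -/

/-- Ranks lie below the cardinality and strictly increase with `j`; a count finishes. -/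
theorem image_rank_eq_range {α : Type*} (S : Finset α) (j : α → ℝ) (hj : Function.Injective j) :
    S.image (fun z => (S.filter fun y => j y < j z).card) = Finset.range S.card := by
  classical
  refine Finset.eq_of_subset_of_card_le (fun n hn => ?_) ?_
  · obtain ⟨z, hz, rfl⟩ := Finset.mem_image.1 hn
    exact Finset.mem_range.2 (Finset.card_lt_card (Finset.filter_ssubset.2 ⟨z, hz, lt_irrefl _⟩))
  · rw [Finset.card_range, Finset.card_image_of_injOn]
    intro z hz z' hz' h
    have hlt : ∀ {a b : α}, a ∈ S → j a < j b →
        (S.filter fun y => j y < j a).card < (S.filter fun y => j y < j b).card := by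
      intro a b ha hab
      refine Finset.card_lt_card ⟨fun y hy => ?_, fun hsub => ?_⟩
      · rw [Finset.mem_filter] at hy ⊢
        exact ⟨hy.1, hy.2.trans hab⟩
      · have := hsub (Finset.mem_filter.2 ⟨ha, hab⟩)
        exact lt_irrefl _ (Finset.mem_filter.1 this).2
    rcases lt_trichotomy (j z) (j z') with h1 | h1 | h1
    · exact absurd h (hlt hz h1).ne
    · exact hj h1
    · exact absurd h (hlt hz' h1).ne'

/-- The points of `E` that have exactly `k` predecessors in `E` in their fibre. -/
def rankSet {X : Type*} (q : X → X) (j : X → ℝ) (E : Set X) (k : ℕ) : Set X :=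
  {z | z ∈ E ∧ (q ⁻¹' {q z} ∩ E ∩ {y | j y < j z}).encard = k}

section RankSets

variable {X : Type*} {q : X → X} {j : X → ℝ} {E : Set X}

/-- Of two points of `E` in one fibre, the later one has strictly more predecessors. -/
theorem injOn_rankSet (hq : ∀ x, (q ⁻¹' {x}).Finite) (hj : Function.Injective j) (k : ℕ) :
    Set.InjOn q (rankSet q j E k) := by
  have hlt : ∀ {a b : X}, a ∈ E → q a = q b → j a < j b →
      (q ⁻¹' {q a} ∩ E ∩ {y | j y < j a}).encard < (q ⁻¹' {q b} ∩ E ∩ {y | j y < j b}).encard := by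
    intro a b ha hab hj
    refine Set.Finite.encard_lt_encard (((hq (q a)).inter_of_left E).inter_of_left _)
      ⟨fun y hy => ?_, fun hsub => ?_⟩
    · exact ⟨hab ▸ hy.1, lt_trans hy.2 hj⟩
    · have : j a < j a := (hsub (⟨⟨hab, ha⟩, hj⟩ : a ∈ q ⁻¹' {q b} ∩ E ∩ {y | j y < j b})).2
      exact lt_irrefl _ this
  intro a ha b hb hab
  rcases lt_trichotomy (j a) (j b) with h1 | h1 | h1
  · have := hlt ha.1 hab h1
    rw [ha.2, hb.2] at this
    exact absurd this (lt_irrefl _)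
  · exact hj h1
  · have := hlt hb.1 hab.symm h1
    rw [ha.2, hb.2] at this
    exact absurd this (lt_irrefl _)

theorem rankSet_disjoint {k l : ℕ} (hkl : k ≠ l) {z : X} (hk : z ∈ rankSet q j E k) :
    z ∉ rankSet q j E l := fun hl => hkl (by
  have := hk.2.symm.trans hl.2
  exact_mod_cast this)

theorem exists_mem_rankSet (hq : ∀ x, (q ⁻¹' {x}).Finite) {z : X} (hz : z ∈ E) :
    ∃ k, z ∈ rankSet q j E k := by
  obtain ⟨k, hk⟩ := ENat.ne_top_iff_exists.1 (Set.encard_ne_top_iff.2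
    (((hq (q z)).inter_of_left E).inter_of_left {y | j y < j z}))
  exact ⟨k, hz, hk.symm⟩

/-- The ranks in a fibre with `N` points of `E` are exactly `0, …, N - 1`; ranks start at `0`,
whence the `k + 1`. -/
theorem exists_mem_rankSet_iff (hq : ∀ x, (q ⁻¹' {x}).Finite) (hj : Function.Injective j) (k : ℕ)
    (x : X) : (∃ z ∈ rankSet q j E k, q z = x) ↔ (k : ℕ∞) + 1 ≤ (q ⁻¹' {x} ∩ E).encard := by
  classical
  have hfin : (q ⁻¹' {x} ∩ E).Finite := (hq x).inter_of_left E
  set S := hfin.toFinset with hS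
  have hcard : (q ⁻¹' {x} ∩ E).encard = S.card := hfin.encard_eq_coe_toFinset_card
  have hrank : ∀ z, q z = x → (q ⁻¹' {q z} ∩ E ∩ {y | j y < j z}).encard =
      (S.filter fun y => j y < j z).card := fun z hz => by
    rw [← Set.encard_coe_eq_coe_finsetCard]
    congr 1
    ext y
    simp [hS, hz, and_assoc]
  have himg := image_rank_eq_range S j hj
  rw [hcard]
  have : ((k : ℕ∞) + 1 ≤ (S.card : ℕ∞)) ↔ k ∈ Finset.range S.card := by
    rw [Finset.mem_range, ← Nat.add_one_le_iff]
    exact_mod_cast Iff.rfl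
  rw [this, ← himg, Finset.mem_image]
  constructor
  · rintro ⟨z, hz, hzx⟩
    refine ⟨z, by simp [hS, hzx, hz.1], ?_⟩
    have := hz.2
    rw [hrank z hzx] at this
    exact_mod_cast this
  · rintro ⟨z, hz, hzk⟩
    have hz' : q z = x ∧ z ∈ E := by simpa [hS] using hz
    exact ⟨z, ⟨hz'.2, by rw [hrank z hz'.1, hzk]⟩, hz'.1⟩

end RankSets

/-! ### Measurability of counts and ranks in the fibres -/

section RankMeasurability

variable {X : Type*} [MeasurableSpace X] [MeasurableSingletonClass X] {ρ : Measure X} {q : X → X}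
  {D : X → ℝ≥0∞}

theorem fibreMeasure_apply_of_finite {x : X} (hq : (q ⁻¹' {x}).Finite) (s : Set X) :
    fibreMeasure q x s = ((q ⁻¹' {x} ∩ s).encard : ℝ≥0∞) := by
  have : Countable (q ⁻¹' {x}) := hq.countable.to_subtype
  rw [fibreMeasure, Measure.sum_apply_of_countable]
  simp_rw [Measure.dirac_apply]
  rw [tsum_subtype (q ⁻¹' {x}) (s.indicator 1), Set.indicator_indicator, ← tsum_subtype]
  exact ENNReal.tsum_set_one _

theorem FibreRegular.aemeasurable_fibreMeasure_apply (h : FibreRegular ρ q D) {s : Set X}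
    (hs : NullMeasurableSet s ρ) : AEMeasurable (fun x => fibreMeasure q x s) ρ := by
  have h1 : ∀ x, fibreMeasure q x s = ∫⁻ y, s.indicator 1 y ∂(fibreMeasure q x) := fun x => by
    have : Countable (q ⁻¹' {x}) := (h.finite x).countable.to_subtype
    rw [lintegral_fibreMeasure, fibreMeasure, Measure.sum_apply_of_countable]
    simp_rw [Measure.dirac_apply]
  simp_rw [h1]
  exact h.aemeasurable_fibre (aemeasurable_const.indicator₀ hs)

theorem FibreRegular.aemeasurable_encard (h : FibreRegular ρ q D) {s : Set X}
    (hs : NullMeasurableSet s ρ) : AEMeasurable (fun x => (q ⁻¹' {x} ∩ s).encard) ρ := by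
  have h1 := h.aemeasurable_fibreMeasure_apply hs
  simp_rw [fun x => fibreMeasure_apply_of_finite (h.finite x) s] at h1
  -- The count is finite, so it is recovered from its `ℝ≥0∞` value by taking the integer part.
  refine (((Measurable.of_discrete (f := ((↑) : ℕ → ℕ∞))).comp
    (Nat.measurable_floor.comp ENNReal.measurable_toReal)).comp_aemeasurable h1).congr
    (Eventually.of_forall fun x => ?_)
  obtain ⟨n, hn⟩ := ENat.ne_top_iff_exists.1
    (Set.encard_ne_top_iff.2 ((h.finite x).inter_of_left s))
  simp [← hn]

theorem FibreRegular.nullMeasurableSet_rankSet (h : FibreRegular ρ q D) {j : X → ℝ}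
    (hj : Measurable j) {E : Set X} (hE : NullMeasurableSet E ρ) (k : ℕ) :
    NullMeasurableSet (rankSet q j E k) ρ := by
  let R : X → ℝ≥0∞ := fun z => fibreMeasure q (q z) (E ∩ {y | j y < j z})
  let C : ℚ → X → ℝ≥0∞ := fun t x => fibreMeasure q x (E ∩ {y | j y < t})
  -- The rank depends on `z` both through the fibre and through the level `j z`. Rational levels
  -- separate the two: for fixed `t` the count is a function of `q z` alone.
  have hR : R = fun z => ⨆ t : ℚ, if (t : ℝ) ≤ j z then C t (q z) else 0 := by
    funext z
    have h1 : E ∩ {y | j y < j z} = ⋃ t : {t : ℚ // (t : ℝ) ≤ j z}, E ∩ {y | j y < (t : ℚ)} := by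
      ext y
      simp only [Set.mem_inter_iff, Set.mem_ofPred_eq, Set.mem_iUnion, Subtype.exists, exists_prop]
      constructor
      · rintro ⟨hy, hlt⟩
        obtain ⟨t, ht1, ht2⟩ := exists_rat_btwn hlt
        exact ⟨t, ht2.le, hy, ht1⟩
      · rintro ⟨t, ht, hy, hyt⟩
        exact ⟨hy, hyt.trans_le ht⟩
    have hdir : Directed (· ⊆ ·) fun t : {t : ℚ // (t : ℝ) ≤ j z} =>
        E ∩ {y | j y < (t : ℚ)} := by
      refine Monotone.directed_le fun s t hst y hy => ⟨hy.1, ?_⟩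
      refine lt_of_lt_of_le (b := ((s : ℚ) : ℝ)) hy.2 ?_
      exact_mod_cast hst
    simp only [R]
    rw [h1, hdir.measure_iUnion, iSup_subtype]
    refine iSup_congr fun t => ?_
    by_cases ht : (t : ℝ) ≤ j z <;> simp [ht, C]
  have hRm : AEMeasurable R ρ := by
    rw [hR]
    refine AEMeasurable.iSup fun t => ?_
    have hC : AEMeasurable (fun z => C t (q z)) ρ :=
      (h.aemeasurable_fibreMeasure_apply (hE.inter
        (measurableSet_lt hj measurable_const).nullMeasurableSet)).comp_quasiMeasurePreserving
        h.quasiMeasurePreserving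
    exact hC.indicator (measurableSet_le measurable_const hj)
  have : rankSet q j E k = E ∩ R ⁻¹' {(k : ℝ≥0∞)} := by
    ext z
    simp only [rankSet, Set.mem_ofPred_eq, Set.mem_inter_iff, Set.mem_preimage,
      Set.mem_singleton_iff, R, fibreMeasure_apply_of_finite (h.finite _), ← Set.inter_assoc]
    refine and_congr_right fun _ => ?_
    rw [← ENat.toENNReal_coe k]
    exact ENat.toENNReal_inj.symm
  rw [this]
  exact hE.inter (hRm.nullMeasurable (measurableSet_singleton _))

end RankMeasurability

/-! ### The multiplicity function of `L^∞(ρ)` acting on `L²(h ρ)` through `f ↦ f ∘ q` -/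

section Existence

variable {X : Type*} [MeasurableSpace X]

/-- The weight of the isometry `L²(ν) → L²(μ)` carried by a set on which `q` is injective. -/
def pieceWeight (q : X → X) (w : X → ℝ≥0∞) (F : Set X) (z : X) : ℂ :=
  F.indicator (fun z => ((Real.sqrt (w (q z)).toReal)⁻¹ : ℂ)) z

theorem enorm_sqrt_inv_sq {t : ℝ≥0∞} (h0 : t ≠ 0) (ht : t ≠ ∞) :
    ‖((Real.sqrt t.toReal)⁻¹ : ℂ)‖ₑ ^ 2 = t⁻¹ := by
  have hpos : 0 < t.toReal := ENNReal.toReal_pos h0 ht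
  rw [← ofReal_norm, norm_inv, Complex.norm_real, Real.norm_of_nonneg (Real.sqrt_nonneg _),
    ← ENNReal.ofReal_pow (by positivity), inv_pow, Real.sq_sqrt hpos.le,
    ENNReal.ofReal_inv_of_pos hpos, ENNReal.ofReal_toReal ht]

/-- One of the pieces: a set `F` on which `q` is injective, the density `w` of the image of
`μ` restricted to `F`, and the image `S` of `F`. -/
structure IsPiece (ρ μ : Measure X) (q : X → X) (F S : Set X) (w : X → ℝ≥0∞) : Prop where
  nullMeasurableSet : NullMeasurableSet F μ
  nullMeasurableSet_image : NullMeasurableSet S ρ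
  injOn : Set.InjOn q F
  measurable_density : Measurable w
  map_eq : (μ.restrict F).map q = ρ.withDensity w
  ae_ne_top : ∀ᵐ x ∂ρ, w x ≠ ∞
  ae_ne_zero_iff : ∀ᵐ x ∂ρ, w x ≠ 0 ↔ x ∈ S

namespace IsPiece

variable {ρ μ : Measure X} {q : X → X} {F S : Set X} {w : X → ℝ≥0∞}

theorem ae_density (h : IsPiece ρ μ q F S w) (hq : Measurable q) (hqμ : μ.map q ≪ ρ) :
    ∀ᵐ z ∂μ, z ∈ F → w (q z) ≠ 0 ∧ w (q z) ≠ ∞ := by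
  have h1 : ∀ᵐ x ∂((μ.restrict F).map q), w x ≠ 0 := by
    rw [h.map_eq, ae_withDensity_iff h.measurable_density]
    exact Eventually.of_forall fun x hx => hx
  have h2 : ∀ᵐ z ∂(μ.restrict F), w (q z) ≠ 0 := ae_of_ae_map hq.aemeasurable h1
  rw [ae_restrict_iff'₀ h.nullMeasurableSet] at h2
  have h3 : ∀ᵐ z ∂μ, w (q z) ≠ ∞ := ae_of_ae_map hq.aemeasurable (hqμ.ae_le h.ae_ne_top)
  filter_upwards [h2, h3] with z hz hz' hzF using ⟨hz hzF, hz'⟩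

theorem measurable_sqrt_inv (h : IsPiece ρ μ q F S w) (hq : Measurable q) :
    Measurable fun z => ((Real.sqrt (w (q z)).toReal)⁻¹ : ℂ) :=
  (Complex.measurable_ofReal.comp
    (h.measurable_density.comp hq).ennreal_toReal.sqrt).inv

theorem aestronglyMeasurable_weight (h : IsPiece ρ μ q F S w) (hq : Measurable q) :
    AEStronglyMeasurable (pieceWeight q w F) μ :=
  (h.measurable_sqrt_inv hq).aestronglyMeasurable.indicator₀ h.nullMeasurableSet

/-- On `F` the measure `μ` pushes forward to `w ρ`. Dividing by `w ∘ q` leaves `ρ` restricted to `{w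
≠ 0}`, which is `S` up to a null set. -/
theorem map_withDensity_weight [SFinite ρ] (h : IsPiece ρ μ q F S w) (hq : Measurable q)
    (hqμ : μ.map q ≪ ρ) :
    (μ.withDensity fun z => ‖pieceWeight q w F z‖ₑ ^ 2).map q = ρ.restrict S := by
  ext s hs
  rw [Measure.map_apply hq hs, withDensity_apply _ (hq hs), ← lintegral_indicator (hq hs)]
  have h1 : ∫⁻ z, (q ⁻¹' s).indicator (fun z => ‖pieceWeight q w F z‖ₑ ^ 2) z ∂μ =
      ∫⁻ z, F.indicator (fun z => s.indicator (fun x => (w x)⁻¹) (q z)) z ∂μ := by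
    refine lintegral_congr_ae ?_
    filter_upwards [h.ae_density hq hqμ] with z hz
    by_cases hzF : z ∈ F
    · by_cases hzs : q z ∈ s
      · simp only [pieceWeight, Set.indicator_of_mem hzF, Set.indicator_of_mem hzs,
          Set.indicator_of_mem (show z ∈ q ⁻¹' s from hzs)]
        exact enorm_sqrt_inv_sq (hz hzF).1 (hz hzF).2
      · simp [hzF, hzs]
    · by_cases hzs : q z ∈ s
      · simp [pieceWeight, hzF, hzs]
      · simp [hzF, hzs]
  rw [h1, lintegral_indicator₀ h.nullMeasurableSet,
    ← lintegral_map (f := s.indicator fun x => (w x)⁻¹) (h.measurable_density.inv.indicator hs) hq, h.map_eq,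
    lintegral_withDensity_eq_lintegral_mul _ h.measurable_density
      (g := s.indicator fun x => (w x)⁻¹) (h.measurable_density.inv.indicator hs)]
  have h2 : ∫⁻ x, (w * s.indicator fun x => (w x)⁻¹) x ∂ρ =
      ∫⁻ x, S.indicator (s.indicator 1) x ∂ρ := by
    refine lintegral_congr_ae ?_
    filter_upwards [h.ae_ne_top, h.ae_ne_zero_iff] with x hx hx'
    by_cases hxs : x ∈ s
    · by_cases hxS : x ∈ S
      · simp [hxs, hxS, ENNReal.mul_inv_cancel (hx'.2 hxS) hx]
      · have : w x = 0 := by by_contra hw; exact hxS (hx'.1 hw)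
        simp [hxS, this]
    · by_cases hxS : x ∈ S <;> simp [hxs, hxS]
  rw [h2, lintegral_indicator₀ h.nullMeasurableSet_image, lintegral_indicator_one hs]

/-- The indicator of `A ∩ F` is in the range of the isometry. -/
theorem exists_eq_indicator [MeasurableSingletonClass X] [IsFiniteMeasure μ] [SFinite ρ]
    {D : X → ℝ≥0∞} (hreg : FibreRegular ρ q D)
    (h : IsPiece ρ μ q F S w) (hF : NullMeasurableSet F ρ) (hqμ : μ.map q ≪ ρ)
    {A : Set X} (hA : MeasurableSet A) :
    ∃ b : X → ℂ, MemLp b 2 (ρ.restrict S) ∧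
      (fun z => pieceWeight q w F z * b (q z)) =ᵐ[μ] (A ∩ F).indicator 1 := by
  classical
  -- `B` is the image `q(A ∩ F)`, written as the set where a count is nonzero so that it is visibly
  -- null measurable. The function `1_B √w` is square integrable because `∫ w dρ = μ(F)`.
  let B : Set X := (fun x => fibreMeasure q x (A ∩ F)) ⁻¹' {0}ᶜ
  have hB : NullMeasurableSet B ρ :=
    (hreg.aemeasurable_fibreMeasure_apply (hA.nullMeasurableSet.inter hF)).nullMeasurable
      (measurableSet_singleton 0).compl
  have hBq : ∀ z, q z ∈ B ↔ ∃ y ∈ A ∩ F, q y = q z := fun z => by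
    simp only [B, Set.mem_preimage, Set.mem_compl_iff, Set.mem_singleton_iff,
      fibreMeasure_apply_of_finite (hreg.finite _)]
    rw [← ENat.toENNReal_zero, ENat.toENNReal_inj, Set.encard_eq_zero, ← ne_eq,
      ← Set.nonempty_iff_ne_empty]
    exact ⟨fun ⟨y, hy1, hy2⟩ => ⟨y, hy2, hy1⟩, fun ⟨y, hy1, hy2⟩ => ⟨y, hy2, hy1⟩⟩
  refine ⟨B.indicator fun x => (Real.sqrt (w x).toReal : ℂ), ?_, ?_⟩
  · have hm : Measurable fun x => (Real.sqrt (w x).toReal : ℂ) :=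
      Complex.measurable_ofReal.comp h.measurable_density.ennreal_toReal.sqrt
    have hint : Integrable (fun x => (w x).toReal) ρ := by
      refine integrable_toReal_of_lintegral_ne_top h.measurable_density.aemeasurable ?_
      rw [← setLIntegral_univ, ← withDensity_apply _ MeasurableSet.univ, ← h.map_eq]
      exact measure_ne_top _ _
    have hg : MemLp (fun x => (Real.sqrt (w x).toReal : ℂ)) 2 ρ := by
      rw [memLp_two_iff_integrable_sq_norm hm.aestronglyMeasurable]
      refine hint.congr (Eventually.of_forall fun x => ?_)
      simp only [Complex.norm_real, Real.norm_eq_abs, sq_abs]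
      exact (Real.sq_sqrt ENNReal.toReal_nonneg).symm
    refine MemLp.restrict S (hg.mono (hm.aestronglyMeasurable.indicator₀ hB)
      (Eventually.of_forall fun x => norm_indicator_le_norm_self _ x))
  · filter_upwards [h.ae_density hreg.measurable hqμ] with z hz
    by_cases hzF : z ∈ F
    · have hiff : q z ∈ B ↔ z ∈ A := by
        rw [hBq]
        exact ⟨fun ⟨y, hy, hyz⟩ => h.injOn hy.2 hzF hyz ▸ hy.1, fun hzA => ⟨z, ⟨hzA, hzF⟩, rfl⟩⟩
      have hne : (Real.sqrt (w (q z)).toReal : ℂ) ≠ 0 := by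
        have := ENNReal.toReal_pos (hz hzF).1 (hz hzF).2
        exact_mod_cast (Real.sqrt_pos.2 this).ne'
      by_cases hzA : z ∈ A
      · simp [pieceWeight, hzF, hzA, hiff.2 hzA, hne]
      · simp [hzA, mt hiff.1 hzA]
    · simp [pieceWeight, hzF]

end IsPiece

theorem FibreRegular.isPiece_rankSet [MeasurableSingletonClass X] {ρ : Measure X}
    [IsFiniteMeasure ρ] {q : X → X} {D h : X → ℝ≥0∞} (hreg : FibreRegular ρ q D)
    (hh : AEMeasurable h ρ) [IsFiniteMeasure (ρ.withDensity h)] {j : X → ℝ} (hj : Measurable j)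
    (hj' : Function.Injective j) (k : ℕ) :
    IsPiece ρ (ρ.withDensity h) q (rankSet q j {z | h z ≠ 0} k)
      {x | (k : ℕ∞) + 1 ≤ (q ⁻¹' {x} ∩ {z | h z ≠ 0}).encard}
      ((((ρ.withDensity h).restrict (rankSet q j {z | h z ≠ 0} k)).map q).rnDeriv ρ) := by
  set E : Set X := {z | h z ≠ 0} with hEdef
  set F := rankSet q j E k with hFdef
  set μ := ρ.withDensity h with hμ
  set S : Set X := {x | (k : ℕ∞) + 1 ≤ (q ⁻¹' {x} ∩ E).encard} with hSdef
  set ν := (μ.restrict F).map q with hν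
  have hE : NullMeasurableSet E ρ := hh.nullMeasurable (measurableSet_singleton 0).compl
  have hF : NullMeasurableSet F ρ := hreg.nullMeasurableSet_rankSet hj hE k
  have hμρ : μ ≪ ρ := withDensity_absolutelyContinuous ρ h
  have hS : NullMeasurableSet S ρ := (hreg.aemeasurable_encard hE).nullMeasurable
    (Set.to_countable (Set.Ici ((k : ℕ∞) + 1))).measurableSet
  have hFS : ∀ x, x ∈ S ↔ ∃ z ∈ F, q z = x := fun x =>
    (exists_mem_rankSet_iff hreg.finite hj' k x).symm
  have hq := hreg.measurable
  have hνρ : ν ≪ ρ := (Measure.restrict_le_self.absolutelyContinuous.map hq).trans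
    ((hμρ.map hq).trans hreg.quasiMeasurePreserving.absolutelyContinuous)
  have hmap : ν = ρ.withDensity (ν.rnDeriv ρ) := (Measure.withDensity_rnDeriv_eq ν ρ hνρ).symm
  have hm : Measurable (ν.rnDeriv ρ) := Measure.measurable_rnDeriv ν ρ
  refine ⟨hF.mono_ac hμρ, hS, injOn_rankSet hreg.finite hj' k, hm, hmap,
    Measure.rnDeriv_ne_top ν ρ, ?_⟩
  have h1 : ∀ᵐ x ∂ρ, ν.rnDeriv ρ x ≠ 0 → x ∈ S := by
    rw [← ae_withDensity_iff hm, ← hmap]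
    -- `S` is only null measurable; a measurable subset of the same measure is needed to test the
    -- image measure.
    obtain ⟨t, htS, ht, hte⟩ := hS.exists_measurable_subset_ae_eq
    have h2 : ∀ᵐ z ∂(μ.restrict F), q z ∈ t := by
      rw [ae_restrict_iff'₀ (hF.mono_ac hμρ)]
      have h3 : ∀ᵐ z ∂ρ, q z ∈ t ↔ q z ∈ S := hreg.quasiMeasurePreserving.ae hte.mem_iff
      filter_upwards [hμρ.ae_le h3] with z hz hzF
      exact hz.2 ((hFS _).2 ⟨z, hzF, rfl⟩)
    have h4 : ∀ᵐ x ∂ν, x ∈ t := (ae_map_iff hq.aemeasurable ht).2 h2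
    filter_upwards [h4] with x hx using htS hx
  have h5 : ∀ᵐ x ∂ρ, x ∈ S → ν.rnDeriv ρ x ≠ 0 := by
    have h6 : ∀ᵐ x ∂ν, ν.rnDeriv ρ x ≠ 0 := by
      have := (ae_withDensity_iff (μ := ρ) hm (p := fun x => ν.rnDeriv ρ x ≠ 0)).2
        (Eventually.of_forall fun x hx => hx)
      rwa [← hmap] at this
    have h7 : ∀ᵐ z ∂(μ.restrict F), ν.rnDeriv ρ (q z) ≠ 0 := ae_of_ae_map hq.aemeasurable h6
    rw [ae_restrict_iff'₀ (hF.mono_ac hμρ), ae_withDensity_iff' hh] at h7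
    -- Since `h ≠ 0` on `F`, the exceptional points of `F` form a `ρ`-null set, which almost no
    -- fibre meets.
    filter_upwards [hreg.ae_fibre h7] with x hx hxS
    obtain ⟨z, hz, hzx⟩ := (hFS x).1 hxS
    have := hx z hzx hz.1 hz
    rwa [hzx] at this
  filter_upwards [h1, h5] with x hx hx' using ⟨hx, hx'⟩

/-- The rank sets partition `{h ≠ 0}`, so `L²(h ρ)` is the Hilbert sum of the `L²(F k)`, each being
the range of the isometry `V k` from `L²(S k, ρ)`. There `f ∘ q` corresponds to `f`. -/
theorem isMultiplicityFunction_of_comp [StandardBorelSpace X] {ρ μ : Measure X}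
    [IsFiniteMeasure ρ] {q : X → X} {D h : X → ℝ≥0∞} (hreg : FibreRegular ρ q D)
    (hh : AEMeasurable h ρ) (hμ : μ = ρ.withDensity h) [IsFiniteMeasure μ] {H : Type*}
    [NormedAddCommGroup H] [InnerProductSpace ℂ H] (π : Lp ℂ ∞ ρ → H →L[ℂ] H)
    (T : Lp ℂ 2 μ ≃ₗᵢ[ℂ] H)
    (hT : ∀ (f : Lp ℂ ∞ ρ) (ξ : Lp ℂ 2 μ),
      T.symm (π f (T ξ)) =ᵐ[μ] fun z => f (q z) * ξ z) :
    IsMultiplicityFunction ρ π fun x => (q ⁻¹' {x} ∩ {z | h z ≠ 0}).encard := by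
  set E : Set X := {z | h z ≠ 0} with hEdef
  let j := embeddingReal X
  have hj : Measurable j := measurable_embeddingReal X
  have hj' : Function.Injective j := (measurableEmbedding_embeddingReal X).injective
  let F : ℕ → Set X := rankSet q j E
  let S : ℕ → Set X := fun k => {x | (k : ℕ∞) + 1 ≤ (q ⁻¹' {x} ∩ E).encard}
  let w : ℕ → X → ℝ≥0∞ := fun k => ((μ.restrict (F k)).map q).rnDeriv ρ
  have hP : ∀ k, IsPiece ρ μ q (F k) (S k) (w k) := fun k => by
    subst hμ
    exact hreg.isPiece_rankSet hh hj hj' k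
  have hE : NullMeasurableSet E ρ := hh.nullMeasurable (measurableSet_singleton 0).compl
  have hF : ∀ k, NullMeasurableSet (F k) ρ := hreg.nullMeasurableSet_rankSet hj hE
  have hq := hreg.measurable
  have hμρ : μ ≪ ρ := hμ ▸ withDensity_absolutelyContinuous ρ h
  have hqμ : μ.map q ≪ ρ :=
    (hμρ.map hq).trans hreg.quasiMeasurePreserving.absolutelyContinuous
  have hμE : ∀ᵐ z ∂μ, z ∈ E := by
    rw [hμ, ae_withDensity_iff' hh]
    exact Eventually.of_forall fun z hz => hz
  choose V hV using fun k => exists_weightedComp hq ((hP k).aestronglyMeasurable_weight hq)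
    ((hP k).map_withDensity_weight hq hqμ)
  have hVself : ∀ k g, V k g =ᵐ[μ] fun z => pieceWeight q (w k) (F k) z * g (q z) :=
    fun k g => hV k g g EventuallyEq.rfl
  have hortho : OrthogonalFamily ℂ (fun k => Lp ℂ 2 (ρ.restrict (S k))) V := by
    intro k l hkl f g
    change inner ℂ (V k f) (V l g) = 0
    rw [L2.inner_def]
    refine integral_eq_zero_of_ae ?_
    filter_upwards [hVself k f, hVself l g] with z h1 h2
    rw [h1, h2]
    by_cases hz : z ∈ F k
    · have : z ∉ F l := rankSet_disjoint hkl hz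
      simp [pieceWeight, this]
    · simp [pieceWeight, hz]
  -- A vector orthogonal to all ranges has zero integral over every `A ∩ F k`, since these
  -- indicators lie in the ranges; hence it vanishes on each `F k`.
  have htotal : ⊤ ≤ (⨆ k, LinearMap.range (V k).toLinearMap).topologicalClosure := by
    rw [top_le_iff, Submodule.topologicalClosure_eq_top_iff, Submodule.eq_bot_iff]
    intro ξ hξ
    have hint : Integrable ξ μ := (Lp.memLp ξ).integrable one_le_two
    have h1 : ∀ k, ∀ᵐ z ∂μ, (F k).indicator ξ z = 0 := fun k => by
      refine Integrable.ae_eq_zero_of_forall_setIntegral_eq_zero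
        (hint.indicator₀ ((hF k).mono_ac hμρ)) fun A hA _ => ?_
      obtain ⟨b, hb, hbe⟩ := (hP k).exists_eq_indicator hreg (hF k) hqμ hA
      have h2 : inner ℂ (V k hb.toLp) ξ = 0 := hξ _
        (Submodule.mem_iSup_of_mem k (LinearMap.mem_range_self (V k).toLinearMap hb.toLp))
      rw [L2.inner_def] at h2
      rw [← integral_indicator hA, ← h2]
      refine integral_congr_ae ?_
      filter_upwards [hV k hb.toLp b hb.coeFn_toLp, hbe] with z h3 h4
      rw [h3, h4]
      by_cases hzA : z ∈ A <;> by_cases hzF : z ∈ F k <;> simp [hzA, hzF]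
    refine Lp.ext ?_
    filter_upwards [ae_all_iff.2 h1, hμE, Lp.coeFn_zero ℂ 2 μ] with z hz hzE h0
    obtain ⟨k, hk⟩ := exists_mem_rankSet (j := j) hreg.finite hzE
    rw [h0, Pi.zero_apply, ← hz k, Set.indicator_of_mem hk]
  have hsum : IsHilbertSum ℂ (fun k => Lp ℂ 2 (ρ.restrict (S k))) V :=
    IsHilbertSum.mk hortho htotal
  let K := hsum.linearIsometryEquiv
  refine ⟨hreg.aemeasurable_encard hE, T.symm.trans K, fun f ψ k => ?_⟩
  have hmul : ∀ k (g : Lp ℂ 2 (ρ.restrict (S k))), MemLp (fun x => f x * g x) 2 (ρ.restrict (S k)) :=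
    fun k g => (Lp.memLp g).mul ((Lp.memLp f).restrict (S k))
  let G := K (T.symm ψ)
  have hHS : HasSum (fun k => T (V k (G k))) ψ := by
    have h1 := hsum.hasSum_linearIsometryEquiv_symm G
    have h2 : hsum.linearIsometryEquiv.symm G = T.symm ψ := K.symm_apply_apply _
    rw [h2] at h1
    simpa using (T.toContinuousLinearEquiv : _ →L[ℂ] H).hasSum h1
  -- Intertwining is checked on one summand at a time, then passed through the convergent sum by
  -- continuity.
  have hterm : ∀ l, K (T.symm (π f (T (V l (G l))))) = lp.single 2 l (hmul l (G l)).toLp := by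
    intro l
    have h1 : T.symm (π f (T (V l (G l)))) = V l (hmul l (G l)).toLp := by
      refine Lp.ext ?_
      filter_upwards [hT f (V l (G l)), hVself l (G l), hV l _ _ (hmul l (G l)).coeFn_toLp]
        with z h1 h2 h3
      rw [h1, h2, h3]
      ring
    rw [h1, ← hsum.linearIsometryEquiv_symm_apply_single]
    exact K.apply_symm_apply _
  have hHS' := (((T.symm.trans K).toContinuousLinearEquiv :
    H →L[ℂ] lp (fun k => Lp ℂ 2 (ρ.restrict (S k))) 2).comp (π f)).hasSum hHS
  have hHS'' := (lp.evalCLM ℂ (fun k => Lp ℂ 2 (ρ.restrict (S k))) 2 k).hasSum hHS'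
  have heq : (K (T.symm (π f ψ))) k = (hmul k (G k)).toLp := by
    refine hHS''.unique ?_
    have h1 : ∀ l, (K (T.symm (π f (T (V l (G l)))))) k =
        if l = k then (hmul k (G k)).toLp else 0 := fun l => by
      rw [hterm l]
      split_ifs with hlk
      · subst hlk
        rw [lp.single_apply_self]
      · rw [lp.single_apply_ne _ _ _ (Ne.symm hlk)]
    refine HasSum.congr_fun (f := fun l => if l = k then (hmul k (G k)).toLp else 0) ?_ ?_
    · exact hasSum_ite_eq k _
    · exact fun l => h1 l
  change (K (T.symm (π f ψ))) k =ᵐ[_] _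
  rw [heq]
  exact (hmul k (G k)).coeFn_toLp

end Existence

/-! ### Paths converging to the cycle -/

/-- The pointwise hypotheses on the endomorphism, the cycle and the filter. -/
structure IsCycleFilter {X : Type*} [MetricSpace X] (r : X → X) {p : ℕ} (c : ZMod p → X)
    (α : ZMod p → ℂ) (m₀ : X → ℂ) : Prop where
  surjective : Function.Surjective r
  finite : ∀ x, (r ⁻¹' {x}).Finite
  isCycle : IsCycle r c
  repelling : IsRepellingCycle r c
  continuousAt : ∀ i, ContinuousAt r (c i)
  continuousAt_card : ∀ i, ContinuousAt (fibreCard r) (c i)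
  norm_phase : ∀ i, ‖α i‖ = 1
  lipschitz : ∀ i, IsBetaLipschitzAt m₀ (c i)
  sum_sq : ∀ x, (1 / (fibreCard r x : ℝ)) * ∑ᶠ y ∈ r ⁻¹' {x}, ‖m₀ y‖ ^ 2 = 1
  low_pass : ∀ i, m₀ (c i) = α i * (Real.sqrt (fibreCard r (r (c i))) : ℂ)

/-- The path `ω` converges to the cycle with index `i`. -/
def Follows {X : Type*} [TopologicalSpace X] {r : X → X} {p : ℕ} (c : ZMod p → X)
    (ω : PathSpace r) (i : ZMod p) : Prop :=
  Tendsto (fun k : ℕ => ω.1 (k * p)) atTop (𝓝 (c i))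

theorem PathSpace.iterate {X : Type*} {r : X → X} (ω : PathSpace r) (m n : ℕ) :
    r^[m] (ω.1 (n + m)) = ω.1 n := by
  induction m with
  | zero => rfl
  | succ m ih => rw [Function.iterate_succ_apply, ← add_assoc, ω.2, ih]

theorem PathSpace.iterate_start {X : Type*} {r : X → X} (ω : PathSpace r) (m : ℕ) :
    r^[m] (ω.1 m) = start ω := by
  have h := ω.iterate m 0
  rwa [zero_add] at h

/-- Summability forces `β(2^{-k}) → 0`, and monotonicity does the rest. -/
theorem IsBetaLipschitzAt.continuousAt {X : Type*} [MetricSpace X] {f : X → ℂ} {x₀ : X}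
    (h : IsBetaLipschitzAt f x₀) : ContinuousAt f x₀ := by
  obtain ⟨β, hmono, hnn, hsum, hev⟩ := h
  rw [Metric.continuousAt_iff']
  intro ε hε
  have h1 := (hsum 1 (1 / 2) one_pos (by norm_num) (by norm_num)).tendsto_atTop_zero
  obtain ⟨k, hk⟩ := (h1.eventually_lt_const hε).exists
  have hpos : (0 : ℝ) < 1 * (1 / 2) ^ (k + 1) := by positivity
  filter_upwards [hev, Metric.ball_mem_nhds x₀ hpos] with x hx hx'
  rw [dist_eq_norm]
  exact (hx.trans (hmono dist_nonneg hpos.le (le_of_lt hx'))).trans_lt hk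

namespace IsCycleFilter

variable {X : Type*} [MetricSpace X] {r : X → X} {p : ℕ} {c : ZMod p → X} {α : ZMod p → ℂ}
  {m₀ : X → ℂ} (h : IsCycleFilter r c α m₀)

include h

theorem map_cycle (i : ZMod p) : r (c i) = c (i - 1) := by
  have := h.isCycle.2 (i - 1)
  rwa [sub_add_cancel] at this

theorem iterate_cycle (l : ℕ) (i : ZMod p) : r^[l] (c i) = c (i - l) := by
  induction l generalizing i with
  | zero => simp
  | succ l ih =>
    rw [Function.iterate_succ_apply, h.map_cycle, ih]
    congr 1
    push_cast
    ring

theorem continuousAt_iterate (l : ℕ) (i : ZMod p) : ContinuousAt r^[l] (c i) := by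
  induction l generalizing i with
  | zero => exact continuousAt_id
  | succ l ih =>
    rw [Function.iterate_succ]
    refine ContinuousAt.comp ?_ (h.continuousAt i)
    rw [h.map_cycle]
    exact ih _

/-- The point `z_{kp+j}` is the image of the later point `z_{(k+j)p}` under `r^{jp-j}`, which is
continuous at `c i` and moves the index by `j` modulo `p`. -/
theorem tendsto_add [NeZero p] {ω : PathSpace r} {i : ZMod p} (hω : Follows c ω i) (j : ℕ) :
    Tendsto (fun k : ℕ => ω.1 (k * p + j)) atTop (𝓝 (c (i + j))) := by
  have hj : j ≤ j * p := Nat.le_mul_of_pos_right j (NeZero.pos p)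
  have h1 : Tendsto (fun k : ℕ => ω.1 ((k + j) * p)) atTop (𝓝 (c i)) :=
    hω.comp (tendsto_add_atTop_nat j)
  have h2 := (h.continuousAt_iterate (j * p - j) i).tendsto.comp h1
  rw [h.iterate_cycle] at h2
  have h3 : i - ((j * p - j : ℕ) : ZMod p) = i + j := by
    rw [Nat.cast_sub hj]
    simp
  rw [h3] at h2
  refine h2.congr fun k => ?_
  have h4 : (k + j) * p = k * p + j + (j * p - j) := by
    rw [add_mul]; omega
  rw [Function.comp_apply, h4, ω.iterate]

theorem follows_shift [NeZero p] {ω : PathSpace r} {i : ZMod p} (hω : Follows c ω i) :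
    Follows c (shift ω) (i - 1) := by
  have h1 := h.tendsto_add hω (p - 1)
  have hp : 1 ≤ p := NeZero.one_le
  have h2 : i + ((p - 1 : ℕ) : ZMod p) = i - 1 := by
    rw [Nat.cast_sub hp]; simp [sub_eq_add_neg]
  rw [h2] at h1
  refine (tendsto_add_atTop_iff_nat 1).1 (h1.congr fun k => ?_)
  have h3 : (k + 1) * p = (k * p + (p - 1)) + 1 := by rw [add_mul]; omega
  rw [h3]
  rfl

theorem follows_of_shift [NeZero p] {ω : PathSpace r} {i : ZMod p} (hω : Follows c (shift ω) i) :
    Follows c ω (i + 1) := by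
  have h1 := h.tendsto_add hω 1
  rwa [Nat.cast_one] at h1

theorem follows_unique {ω : PathSpace r} {i j : ZMod p} (hi : Follows c ω i)
    (hj : Follows c ω j) : i = j :=
  h.isCycle.1 (tendsto_nhds_unique hi hj)

theorem cycleIndex_eq {ω : PathSpace r} {i : ZMod p} (hi : Follows c ω i) :
    cycleIndex c ω = i := by
  have hex : ∃ i, Tendsto (fun k : ℕ => ω.1 (k * p)) atTop (𝓝 (c i)) := ⟨i, hi⟩
  rw [cycleIndex, dif_pos hex]
  exact h.follows_unique hex.choose_spec hi

theorem follows_cycleIndex {ω : PathSpace r} {x : X} (hω : ω ∈ cyclePaths r c x) :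
    Follows c ω (cycleIndex c ω) := by
  obtain ⟨i, hi⟩ := hω.2
  rw [h.cycleIndex_eq hi]
  exact hi

theorem card_pos (x : X) : 0 < fibreCard r x := fibreCard_pos h.surjective h.finite x

theorem sum_filterWeight (x : X) : ∑ y ∈ (h.finite x).toFinset, filterWeight r m₀ y = 1 := by
  rw [← h.sum_sq x, finsum_mem_eq_finite_toFinset_sum _ (h.finite x), Finset.mul_sum]
  refine Finset.sum_congr rfl fun y hy => ?_
  have hy' : r y = x := by simpa using hy
  rw [filterWeight, hy']
  ring

theorem continuousAt_card_comp (i : ZMod p) :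
    ContinuousAt (fun y => (fibreCard r (r y) : ℝ)) (c i) := by
  have h1 : ContinuousAt (fun y => fibreCard r (r y)) (c i) := by
    refine ContinuousAt.comp (f := r) (g := fibreCard r) ?_ (h.continuousAt i)
    rw [h.map_cycle]
    exact h.continuousAt_card _
  exact (continuous_of_discreteTopology (f := ((↑) : ℕ → ℝ))).continuousAt.comp h1

/-- A continuous function with values in the discrete space `ℕ` is locally constant. -/
theorem eventually_card_eq (i : ZMod p) :
    ∀ᶠ y in 𝓝 (c i), fibreCard r (r y) = fibreCard r (r (c i)) := by
  have h1 : ContinuousAt (fun y => fibreCard r (r y)) (c i) := by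
    refine ContinuousAt.comp (f := r) (g := fibreCard r) ?_ (h.continuousAt i)
    rw [h.map_cycle]
    exact h.continuousAt_card _
  exact h1.tendsto.eventually_mem (s := {fibreCard r (r (c i))})
    ((isOpen_discrete _).mem_nhds rfl)

theorem filterWeight_cycle (i : ZMod p) : filterWeight r m₀ (c i) = 1 := by
  have h1 : (0 : ℝ) < fibreCard r (r (c i)) := by exact_mod_cast h.card_pos _
  rw [filterWeight, h.low_pass, norm_mul, h.norm_phase, one_mul, Complex.norm_real,
    Real.norm_of_nonneg (Real.sqrt_nonneg _), Real.sq_sqrt h1.le, div_self h1.ne']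

theorem continuousAt_filterWeight (i : ZMod p) : ContinuousAt (filterWeight r m₀) (c i) :=
  ((h.lipschitz i).continuousAt.norm.pow 2).div (h.continuousAt_card_comp i)
    (by exact_mod_cast (h.card_pos _).ne')

/-- By the quadrature condition, `r` is injective near the points of the cycle. -/
theorem exists_injOn_nhds (i : ZMod p) : ∃ V : Set X, IsOpen V ∧ c i ∈ V ∧ Set.InjOn r V := by
  -- The weight is 1 at `c i`. Two distinct points of a fibre, both of weight above 1/2, would
  -- exceed the total weight 1.
  have h1 : ∀ᶠ y in 𝓝 (c i), 1 / 2 < filterWeight r m₀ y := by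
    refine (h.continuousAt_filterWeight i).eventually_const_lt ?_
    rw [h.filterWeight_cycle]
    norm_num
  obtain ⟨V, hV, hVo, hVc⟩ := mem_nhds_iff.1 h1
  classical
  refine ⟨V, hVo, hVc, fun y hy y' hy' hyy' => ?_⟩
  by_contra hne
  have h2 : ∑ z ∈ ({y, y'} : Finset X), filterWeight r m₀ z ≤ 1 := by
    rw [← h.sum_filterWeight (r y)]
    refine Finset.sum_le_sum_of_subset_of_nonneg ?_ fun z _ _ => ?_
    · intro z hz
      rcases Finset.mem_insert.1 hz with rfl | hz
      · simp
      · rw [Finset.mem_singleton.1 hz]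
        simp [hyy']
    · unfold filterWeight
      positivity
  rw [Finset.sum_pair hne] at h2
  have h3 : 1 / 2 < filterWeight r m₀ y := hV hy
  have h4 : 1 / 2 < filterWeight r m₀ y' := hV hy'
  linarith

theorem eventually_mem [NeZero p] {V : ZMod p → Set X} (hV : ∀ i, V i ∈ 𝓝 (c i))
    {ω : PathSpace r} {i : ZMod p} (hω : Follows c ω i) :
    ∀ᶠ n : ℕ in atTop, ω.1 n ∈ V (i + n) := by
  have h1 : ∀ j ∈ Finset.range p, ∀ᶠ k : ℕ in atTop, ω.1 (k * p + j) ∈ V (i + j) :=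
    fun j _ => h.tendsto_add hω j (hV _)
  have h2 := (Finset.eventually_all (Finset.range p)).2 h1
  obtain ⟨K, hK⟩ := eventually_atTop.1 h2
  refine eventually_atTop.2 ⟨K * p, fun n hn => ?_⟩
  have h3 := hK (n / p) ((Nat.le_div_iff_mul_le (NeZero.pos p)).2 hn) (n % p)
    (Finset.mem_range.2 (Nat.mod_lt _ (NeZero.pos p)))
  rw [Nat.div_add_mod' n p] at h3
  have h4 : ((n % p : ℕ) : ZMod p) = n := ZMod.natCast_mod n p
  rwa [h4] at h3

/-- The repelling inequality at `z_{(k+1)p+j}`, whose image under `r^p` is `z_{kp+j}`, is a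
contraction along the path. -/
theorem decay [NeZero p] {ω : PathSpace r} {i : ZMod p} (hω : Follows c ω i) (j : ℕ) :
    ∃ (A a : ℝ) (K : ℕ), 0 < A ∧ 0 < a ∧ a < 1 ∧
      ∀ k, dist (ω.1 ((k + K) * p + j)) (c (i + j)) ≤ A * a ^ (k + 1) := by
  obtain ⟨-, a, δ, ha0, ha1, hδ, hrep⟩ := h.repelling (i + j)
  have hlim := h.tendsto_add hω j
  obtain ⟨K, hK⟩ := eventually_atTop.1 (hlim (Metric.ball_mem_nhds _ hδ))
  have hstep : ∀ k, K ≤ k → dist (ω.1 ((k + 1) * p + j)) (c (i + j)) ≤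
      a * dist (ω.1 (k * p + j)) (c (i + j)) := fun k hk => by
    by_cases heq : ω.1 ((k + 1) * p + j) = c (i + j)
    · rw [heq, dist_self]
      positivity
    · have h1 := hrep _ heq (hK (k + 1) (by omega))
      have h2 : (k + 1) * p + j = k * p + j + p := by ring
      rw [h2, ω.iterate p (k * p + j), ← h2, inv_mul_lt_iff₀ ha0] at h1
      exact h1.le
  -- Division by `a` compensates the exponent `k + 1` at `k = 0`; adding 1 keeps the constant
  -- positive when the distance is zero.
  refine ⟨dist (ω.1 (K * p + j)) (c (i + j)) / a + 1, a, K, by positivity, ha0, ha1, fun k => ?_⟩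
  induction k with
  | zero =>
    rw [zero_add, zero_add, pow_one, add_mul, div_mul_cancel₀ _ ha0.ne']
    linarith
  | succ k ih =>
    have h1 := hstep (k + K) (by omega)
    rw [show k + 1 + K = k + K + 1 by ring, pow_succ]
    refine h1.trans ?_
    rw [← mul_assoc, mul_comm _ a]
    exact mul_le_mul_of_nonneg_left ih ha0.le

/-- The factors of the scaling function. -/
theorem summable_factor [NeZero p] {ω : PathSpace r} {i : ZMod p} (hω : Follows c ω i) :
    Summable fun n : ℕ => ‖(α (i + n))⁻¹ * m₀ (ω.1 n) /
      (Real.sqrt (fibreCard r (r (ω.1 n))) : ℂ) - 1‖ := by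
  -- In a fixed residue class modulo `p`, the low-pass condition turns the deviation of the factor
  -- from 1 into `(m₀(z) - m₀(c))/√N` up to a phase. It is at most `β(A a^{k+1})` eventually.
  have hres : ∀ j : ℕ, Summable fun k : ℕ => ‖(α (i + j))⁻¹ * m₀ (ω.1 (k * p + j)) /
      (Real.sqrt (fibreCard r (r (ω.1 (k * p + j)))) : ℂ) - 1‖ := fun j => by
    obtain ⟨A, a, K, hA, ha0, ha1, hdec⟩ := h.decay hω j
    obtain ⟨β, hmono, hnn, hsum, hev⟩ := h.lipschitz (i + j)
    have hlim := h.tendsto_add hω j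
    obtain ⟨M, hM⟩ := eventually_atTop.1 (hlim (hev.and (h.eventually_card_eq (i + j))))
    rw [← summable_nat_add_iff (K + M)]
    refine Summable.of_nonneg_of_le (fun _ => norm_nonneg _) (fun k => ?_)
      ((summable_nat_add_iff M).2 (hsum A a hA ha0 ha1))
    obtain ⟨h1, h2⟩ := hM (k + (K + M)) (by omega)
    have h3 := hdec (k + M)
    rw [show k + M + K = k + (K + M) by ring] at h3
    set z := ω.1 ((k + (K + M)) * p + j)
    have h2' : fibreCard r (r z) = fibreCard r (r (c (i + j))) := h2
    rw [h2']
    set N := fibreCard r (r (c (i + j))) with hN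
    have hNpos : 1 ≤ N := h.card_pos _
    have hs1 : 1 ≤ Real.sqrt N := Real.one_le_sqrt.2 (by exact_mod_cast hNpos)
    have hs0 : (Real.sqrt N : ℂ) ≠ 0 := by exact_mod_cast (zero_lt_one.trans_le hs1).ne'
    have hα0 : α (i + j) ≠ 0 := by
      rw [← norm_ne_zero_iff, h.norm_phase]; exact one_ne_zero
    have h4 : (α (i + j))⁻¹ * m₀ z / (Real.sqrt N : ℂ) - 1 =
        (α (i + j))⁻¹ * (m₀ z - m₀ (c (i + j))) / (Real.sqrt N : ℂ) := by
      rw [h.low_pass, ← hN]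
      field_simp
    rw [h4, norm_div, norm_mul, norm_inv, h.norm_phase, inv_one, one_mul, Complex.norm_real,
      Real.norm_of_nonneg (Real.sqrt_nonneg _)]
    calc ‖m₀ z - m₀ (c (i + j))‖ / Real.sqrt N ≤ ‖m₀ z - m₀ (c (i + j))‖ :=
          div_le_self (norm_nonneg _) hs1
      _ ≤ β (dist z (c (i + j))) := h1
      _ ≤ _ := hmono dist_nonneg (by simp only [Set.mem_Ici]; positivity) h3
  set g : ℕ → ℝ := fun n => ‖(α (i + n))⁻¹ * m₀ (ω.1 n) /
    (Real.sqrt (fibreCard r (r (ω.1 n))) : ℂ) - 1‖ with hg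
  -- The `p` residue classes are reassembled through division with remainder.
  have h1 : Summable fun q : Fin p × ℕ => g (q.2 * p + q.1) := by
    rw [summable_prod_of_nonneg fun _ => norm_nonneg _]
    refine ⟨fun j => ?_, Summable.of_finite⟩
    refine (hres j).congr fun k => ?_
    simp
  have h2 := (Equiv.prodComm ℕ (Fin p)).summable_iff.2 h1
  exact (Nat.divModEquiv p).symm.summable_iff.1 h2

theorem multipliable_factor [NeZero p] {ω : PathSpace r} {i : ZMod p} (hω : Follows c ω i) :
    Multipliable fun k : ℕ => (α (i + ((k + 1 : ℕ) : ZMod p)))⁻¹ * m₀ (ω.1 (k + 1)) /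
      (Real.sqrt (fibreCard r (r (ω.1 (k + 1)))) : ℂ) := by
  have h1 := (summable_nat_add_iff 1).2 (h.summable_factor hω)
  have h2 := multipliable_one_add_of_summable h1
  refine h2.congr fun k => ?_
  simp

theorem norm_factor_sq (i : ZMod p) (z : X) :
    ‖(α i)⁻¹ * m₀ z / (Real.sqrt (fibreCard r (r z)) : ℂ)‖ ^ 2 = filterWeight r m₀ z := by
  rw [norm_div, norm_mul, norm_inv, h.norm_phase, inv_one, one_mul, Complex.norm_real,
    Real.norm_of_nonneg (Real.sqrt_nonneg _), div_pow, Real.sq_sqrt (Nat.cast_nonneg _),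
    filterWeight]

theorem tendsto_prod_filterWeight [NeZero p] {ω : PathSpace r} {x : X}
    (hω : ω ∈ cyclePaths r c x) :
    Tendsto (fun n => ∏ k ∈ Finset.range n, filterWeight r m₀ (ω.1 (k + 1))) atTop
      (𝓝 (‖scalingFunction r c α m₀ ω‖ ^ 2)) := by
  have h1 := (h.multipliable_factor (h.follows_cycleIndex hω)).hasProd.tendsto_prod_nat
  refine (h1.norm.pow 2).congr fun n => ?_
  rw [norm_prod, ← Finset.prod_pow]
  exact Finset.prod_congr rfl fun k _ => h.norm_factor_sq _ _

end IsCycleFilter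

/-! ### Countability of the set of paths converging to the cycle -/

/-- The paths that converge to the cycle with index `i` and stay in the sets `V` from time `K` on. -/
def cyclePiece {X : Type*} [TopologicalSpace X] {r : X → X} {p : ℕ} (c : ZMod p → X)
    (V : ZMod p → Set X) (i : ZMod p) (K : ℕ) : Set (PathSpace r) :=
  {ω | Follows c ω i ∧ ∀ n, K ≤ n → ω.1 n ∈ V (i + n)}

/-- Points before time `K` are forward images of `z_K`; later ones are determined by injectivity of
`r` on the sets `V`. -/
theorem injOn_cyclePiece {X : Type*} [TopologicalSpace X] {r : X → X} {p : ℕ} {c : ZMod p → X}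
    {V : ZMod p → Set X} (hV : ∀ i, Set.InjOn r (V i)) (i : ZMod p) (K : ℕ) :
    Set.InjOn (fun ω : PathSpace r => ω.1 K) (cyclePiece c V i K) := by
  intro ω hω ω' hω' heq
  have heq' : ω.1 K = ω'.1 K := heq
  refine Subtype.ext (funext fun n => ?_)
  rcases le_total K n with hn | hn
  · induction n, hn using Nat.le_induction with
    | base => exact heq'
    | succ n hn ih =>
      exact hV _ (hω.2 (n + 1) (by omega)) (hω'.2 (n + 1) (by omega)) (by rw [ω.2, ω'.2, ih])
  · obtain ⟨m, rfl⟩ := Nat.exists_eq_add_of_le hn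
    rw [← ω.iterate m n, ← ω'.iterate m n, heq']

namespace IsCycleFilter

variable {X : Type*} [MetricSpace X] {r : X → X} {p : ℕ} {c : ZMod p → X} {α : ZMod p → ℂ}
  {m₀ : X → ℂ} (h : IsCycleFilter r c α m₀)

include h

theorem exists_nhds : ∃ V : ZMod p → Set X, (∀ i, IsOpen (V i)) ∧ (∀ i, V i ∈ 𝓝 (c i)) ∧
    ∀ i, Set.InjOn r (V i) := by
  choose V hVo hVc hVi using h.exists_injOn_nhds
  exact ⟨V, hVo, fun i => (hVo i).mem_nhds (hVc i), hVi⟩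

theorem exists_mem_cyclePiece [NeZero p] {V : ZMod p → Set X} (hV : ∀ i, V i ∈ 𝓝 (c i))
    {ω : PathSpace r} {i : ZMod p} (hω : Follows c ω i) : ∃ K, ω ∈ cyclePiece c V i K := by
  obtain ⟨K, hK⟩ := eventually_atTop.1 (h.eventually_mem hV hω)
  exact ⟨K, hω, hK⟩

theorem finite_preimage_iterate (K : ℕ) (x : X) : (r^[K] ⁻¹' {x}).Finite := by
  induction K generalizing x with
  | zero => exact Set.finite_singleton x
  | succ K ih =>
    rw [Function.iterate_succ, Set.preimage_comp]
    exact (ih x).preimage' fun b _ => h.finite b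

/-- The paths from `x` in a piece with given `i` and `K` are embedded by `z_K` into the finite set
`r^{-K}(x)`. -/
theorem countable_cyclePaths [NeZero p] (x : X) : (cyclePaths r c x).Countable := by
  obtain ⟨V, -, hVn, hVi⟩ := h.exists_nhds
  have hsub : cyclePaths r c x ⊆ ⋃ i, ⋃ K, {ω | ω ∈ cyclePiece c V i K ∧ start ω = x} := by
    rintro ω ⟨hx, i, hi⟩
    obtain ⟨K, hK⟩ := h.exists_mem_cyclePiece hVn hi
    simp only [Set.mem_iUnion]
    exact ⟨i, K, hK, hx⟩
  refine Set.Countable.mono hsub (Set.countable_iUnion fun i => Set.countable_iUnion fun K => ?_)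
  refine Set.Finite.countable (Set.Finite.of_finite_image
    ((h.finite_preimage_iterate K x).subset ?_)
    ((injOn_cyclePiece hVi i K).mono fun ω hω => hω.1))
  rintro _ ⟨ω, hω, rfl⟩
  exact (ω.iterate_start K).trans hω.2

end IsCycleFilter

/-! ### The law of the random walk -/

section Walk

variable {X : Type*}

instance : DiscreteMeasurableSpace (Disc X) := ⟨fun _ => trivial⟩

theorem partialTraj_singleton (r : X → X) (W : X → ℝ) (a : ℕ → Disc X) (n : ℕ) :
    Kernel.partialTraj (X := fun _ => Disc X) (stepKernel r W) 0 n (fun _ => a 0)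
      {Preorder.frestrictLe (π := fun _ => Disc X) n a} =
      ∏ k ∈ Finset.range n, stepMeasure r W (a k) {a (k + 1)} := by
  induction n with
  | zero =>
    rw [Kernel.partialTraj_self, Kernel.id_apply, Measure.dirac_apply' _ (measurableSet_singleton _)]
    have h0 : (fun _ => a 0) = Preorder.frestrictLe (π := fun _ => Disc X) 0 a := by
      funext i
      have hi : (i : ℕ) = 0 := Nat.le_zero.1 (Finset.mem_Iic.1 i.2)
      rw [Preorder.frestrictLe_apply, hi]
    simp [h0]
  | succ n ih =>
    rw [Kernel.partialTraj_succ_eq_comp (Nat.zero_le n),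
      Kernel.comp_apply' _ _ _ (measurableSet_singleton _)]
    -- One more step can reach the prescribed history only if `b` already agrees with it up to time
    -- `n`.
    have hstep : ∀ b : (i : Finset.Iic n) → Disc X,
        Kernel.partialTraj (X := fun _ => Disc X) (stepKernel r W) n (n + 1) b
          {Preorder.frestrictLe (π := fun _ => Disc X) (n + 1) a} =
          Set.indicator {Preorder.frestrictLe (π := fun _ => Disc X) n a}
            (fun _ => stepMeasure r W (a n) {a (n + 1)}) b := fun b => by
      let a' : (i : Finset.Ioc n (n + 1)) → Disc X := fun i => a i
      have hm : Measurable (MeasurableEquiv.piSingleton (X := fun _ => Disc X) n) :=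
        (MeasurableEquiv.piSingleton (X := fun _ => Disc X) n).measurable
      rw [Kernel.partialTraj_succ_self, Kernel.map_apply' _
        (measurable_IicProdIoc (X := fun _ => Disc X) (m := n) (n := n + 1)) _
        (measurableSet_singleton _)]
      have hpre : IicProdIoc (X := fun _ => Disc X) n (n + 1) ⁻¹'
          {Preorder.frestrictLe (π := fun _ => Disc X) (n + 1) a} =
          {Preorder.frestrictLe (π := fun _ => Disc X) n a} ×ˢ {a'} := by
        ext u
        simp only [Set.mem_preimage, Set.mem_singleton_iff, Set.mem_prod]
        rw [← MeasurableEquiv.coe_IicProdIoc (Nat.le_succ n)]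
        rw [← MeasurableEquiv.eq_symm_apply, MeasurableEquiv.coe_IicProdIoc_symm, Prod.ext_iff]
        rfl
      have hK : IsMarkovKernel ((stepKernel r W n).map
          (MeasurableEquiv.piSingleton (X := fun _ => Disc X) n)) :=
        Kernel.IsMarkovKernel.map _ hm
      have hpre2 : MeasurableEquiv.piSingleton (X := fun _ => Disc X) n ⁻¹' {a'} =
          {a (n + 1)} := by
        ext y
        simp only [Set.mem_preimage, Set.mem_singleton_iff]
        rw [← MeasurableEquiv.eq_symm_apply]
        rfl
      have hlast : (stepKernel r W n).map
          (MeasurableEquiv.piSingleton (X := fun _ => Disc X) n) b {a'} =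
          stepKernel r W n b {a (n + 1)} := by
        rw [Kernel.map_apply' _ hm _ (measurableSet_singleton a'), hpre2]
      rw [hpre, Kernel.prod_apply_prod, Kernel.id_apply,
        Measure.dirac_apply' _ (measurableSet_singleton _), hlast]
      by_cases hb : b = Preorder.frestrictLe (π := fun _ => Disc X) n a
      · subst hb
        simp [stepKernel]
      · simp [hb]
    simp_rw [hstep]
    rw [lintegral_indicator (measurableSet_singleton _), setLIntegral_const, ih,
      Finset.prod_range_succ, mul_comm]

/-- A single trajectory is the decreasing intersection of the cylinders fixing its first
coordinates. -/
theorem traj_singleton (r : X → X) (W : X → ℝ) (a : ℕ → Disc X) :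
    Tendsto (fun n => ∏ k ∈ Finset.range n, stepMeasure r W (a k) {a (k + 1)}) atTop
      (𝓝 (Kernel.traj (X := fun _ => Disc X) (stepKernel r W) 0 (fun _ => a 0) {a})) := by
  set μ := Kernel.traj (X := fun _ => Disc X) (stepKernel r W) 0 (fun _ => a 0)
  let s : ℕ → Set (ℕ → Disc X) := fun n =>
    Preorder.frestrictLe (π := fun _ => Disc X) n ⁻¹'
      {Preorder.frestrictLe (π := fun _ => Disc X) n a}
  have hsm : ∀ n, MeasurableSet (s n) := fun n =>
    (Preorder.measurable_frestrictLe n) (measurableSet_singleton _)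
  have hs : ∀ n, μ (s n) = ∏ k ∈ Finset.range n, stepMeasure r W (a k) {a (k + 1)} := fun n => by
    rw [← Measure.map_apply (Preorder.measurable_frestrictLe n) (measurableSet_singleton _),
      Kernel.traj_map_frestrictLe_apply, partialTraj_singleton]
  have hmem : ∀ n z, z ∈ s n ↔ ∀ k ≤ n, z k = a k := fun n z =>
    ⟨fun hz k hk => congrFun (show Preorder.frestrictLe (π := fun _ => Disc X) n z =
      Preorder.frestrictLe (π := fun _ => Disc X) n a from hz) ⟨k, Finset.mem_Iic.2 hk⟩,
      fun hz => funext fun i => hz i (Finset.mem_Iic.1 i.2)⟩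
  have hanti : Antitone s := fun m n hmn z hz =>
    (hmem m z).2 fun k hk => (hmem n z).1 hz k (hk.trans hmn)
  have hint : ⋂ n, s n = {a} := by
    ext z
    simp only [Set.mem_iInter, Set.mem_singleton_iff, hmem]
    exact ⟨fun hz => funext fun n => hz n n le_rfl, fun hz n k _ => congrFun hz k⟩
  have h1 := tendsto_measure_iInter_atTop (μ := μ) (fun n => (hsm n).nullMeasurableSet) hanti
    ⟨0, measure_ne_top _ _⟩
  rw [hint] at h1
  exact h1.congr hs

theorem measurableSet_pathSpace [TopologicalSpace X] [T2Space X] [SecondCountableTopology X]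
    [MeasurableSpace X] [BorelSpace X] {r : X → X} (hr : Measurable r) :
    MeasurableSet {z : ℕ → X | ∀ n, r (z (n + 1)) = z n} := by
  rw [Set.ofPred_forall]
  exact MeasurableSet.iInter fun n =>
    measurableSet_eq_fun (hr.comp (measurable_pi_apply _)) (measurable_pi_apply _)

theorem measurable_discVal [MeasurableSpace X] :
    Measurable fun (z : ℕ → Disc X) (n : ℕ) => (z n).val :=
  measurable_pi_lambda _ fun n => (measurable_from_top (f := Disc.val)).comp (measurable_pi_apply n)

theorem walkMeasure_apply [TopologicalSpace X] [T2Space X] [SecondCountableTopology X]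
    [MeasurableSpace X] [BorelSpace X] {r : X → X} (hr : Measurable r) (W : X → ℝ) (x : X)
    {s : Set (PathSpace r)} (hs : MeasurableSet s) : walkMeasure r W x s =
      Kernel.traj (X := fun _ => Disc X) (stepKernel r W) 0 (fun _ => Disc.of x)
        ((fun (z : ℕ → Disc X) (n : ℕ) => (z n).val) ⁻¹' (Subtype.val '' s)) := by
  have he : MeasurableEmbedding (Subtype.val : PathSpace r → ℕ → X) :=
    MeasurableEmbedding.subtype_coe (measurableSet_pathSpace hr)
  rw [walkMeasure, he.comap_apply, Measure.map_apply measurable_discVal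
    (he.measurableSet_image.2 hs)]

theorem walkMeasure_univ_le_one [TopologicalSpace X] [T2Space X] [SecondCountableTopology X]
    [MeasurableSpace X] [BorelSpace X] {r : X → X} (hr : Measurable r) (W : X → ℝ) (x : X) :
    walkMeasure r W x Set.univ ≤ 1 := by
  rw [walkMeasure_apply hr W x MeasurableSet.univ]
  exact prob_le_one

theorem walkMeasure_singleton [TopologicalSpace X] [T2Space X] [SecondCountableTopology X]
    [MeasurableSpace X] [BorelSpace X] {r : X → X} (hr : Measurable r) (W : X → ℝ)
    (ω : PathSpace r) :
    Tendsto (fun n => ∏ k ∈ Finset.range n,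
      stepMeasure r W (Disc.of (ω.1 k)) {Disc.of (ω.1 (k + 1))}) atTop
      (𝓝 (walkMeasure r W (start ω) {ω})) := by
  rw [walkMeasure_apply hr W _ (measurableSet_singleton ω)]
  have := traj_singleton r W fun n => Disc.of (ω.1 n)
  have hset : (fun (z : ℕ → Disc X) (n : ℕ) => (z n).val) ⁻¹' (Subtype.val '' {ω}) =
      {fun n => Disc.of (ω.1 n)} := by
    rw [Set.image_singleton]
    rfl
  rw [hset]
  exact this

end Walk

theorem harmonicFunction_le_one {X : Type*} [TopologicalSpace X] [T2Space X] [SecondCountableTopology X] [MeasurableSpace X] [BorelSpace X]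
    {r : X → X} {p : ℕ} (c : ZMod p → X) (m₀ : X → ℂ) (hr : Measurable r) (x : X) : ENNReal.ofReal (harmonicFunction r c m₀ x) ≤ 1 := by
  have h1 := walkMeasure_univ_le_one hr (filterWeight r m₀) x
  have : IsFiniteMeasure (walkMeasure r (filterWeight r m₀) x) :=
    ⟨h1.trans_lt ENNReal.one_lt_top⟩
  rw [harmonicFunction, ofReal_measureReal]
  exact (measure_mono (Set.subset_univ _)).trans h1

/-! ### The scaling function and the harmonic function -/

namespace IsCycleFilter

variable {X : Type*} [MetricSpace X] {r : X → X} {p : ℕ} {c : ZMod p → X} {α : ZMod p → ℂ}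
  {m₀ : X → ℂ} (h : IsCycleFilter r c α m₀)

include h

/-- The quadrature condition makes the total weight of each fibre 1, so the fallback branch of
`stepMeasure` never occurs. -/
theorem stepMeasure_singleton {x y : X} (hxy : r y = x) :
    stepMeasure r (filterWeight r m₀) (Disc.of x) {Disc.of y} =
      ENNReal.ofReal (filterWeight r m₀ y) := by
  have hnn : ∀ z, 0 ≤ filterWeight r m₀ z := fun z => by unfold filterWeight; positivity
  have h1 : ∑' z : r ⁻¹' {x}, ENNReal.ofReal (filterWeight r m₀ z) = 1 := by
    have hf := h.sum_filterWeight x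
    rw [← ENNReal.ofReal_one, ← hf, ENNReal.ofReal_sum_of_nonneg fun z _ => hnn z]
    rw [tsum_subtype (r ⁻¹' {x}) fun z => ENNReal.ofReal (filterWeight r m₀ z),
      tsum_eq_sum (s := (h.finite x).toFinset) fun z hz =>
        Set.indicator_of_notMem (by simpa using hz) _]
    exact Finset.sum_congr rfl fun z hz => Set.indicator_of_mem (by simpa using hz) _
  have h2 : (Measure.sum fun y : r ⁻¹' {(Disc.of x).val} =>
    ENNReal.ofReal (filterWeight r m₀ y) • Measure.dirac (Disc.of (y : X))) Set.univ = 1 := by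
    rw [Measure.sum_apply _ MeasurableSet.univ]
    refine Eq.trans (tsum_congr fun y => ?_) h1
    simp
  unfold stepMeasure
  simp only
  rw [if_pos h2, Measure.sum_apply _ (measurableSet_singleton _),
    tsum_eq_single (⟨y, hxy⟩ : r ⁻¹' {(Disc.of x).val})]
  · simp
  · intro z hz
    have : Disc.of (z : X) ∉ ({Disc.of y} : Set (Disc X)) := fun hmem => hz (Subtype.ext hmem)
    simp [this]

/-- Both sides are the limit of the same partial products of `W(z_k)`. -/
theorem walkMeasure_singleton [SecondCountableTopology X] [MeasurableSpace X] [BorelSpace X]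
    [NeZero p] (hr : Measurable r) {ω : PathSpace r} {x : X} (hω : ω ∈ cyclePaths r c x) :
    walkMeasure r (filterWeight r m₀) x {ω} = ‖scalingFunction r c α m₀ ω‖ₑ ^ 2 := by
  have h1 := CycleRep.walkMeasure_singleton hr (filterWeight r m₀) ω
  rw [hω.1] at h1
  refine tendsto_nhds_unique h1 ?_
  have h2 := ENNReal.tendsto_ofReal (h.tendsto_prod_filterWeight hω)
  rw [ENNReal.ofReal_pow (norm_nonneg _), ofReal_norm] at h2
  refine h2.congr fun n => ?_
  rw [ENNReal.ofReal_prod_of_nonneg fun k _ => by unfold filterWeight; positivity]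
  exact Finset.prod_congr rfl fun k _ => (h.stepMeasure_singleton (ω.2 k)).symm

theorem ofReal_harmonicFunction [SecondCountableTopology X] [MeasurableSpace X] [BorelSpace X]
    [NeZero p] (hr : Measurable r) (x : X) :
    ENNReal.ofReal (harmonicFunction r c m₀ x) =
      ∑' ω : cyclePaths r c x, ‖scalingFunction r c α m₀ ω‖ₑ ^ 2 := by
  have : IsFiniteMeasure (walkMeasure r (filterWeight r m₀) x) :=
    ⟨(walkMeasure_univ_le_one hr _ x).trans_lt ENNReal.one_lt_top⟩
  have h1 := measure_biUnion (μ := walkMeasure r (filterWeight r m₀) x)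
    (f := fun ω : PathSpace r => {ω}) (h.countable_cyclePaths x)
    (fun a _ b _ hab => by simpa using hab) fun a _ => measurableSet_singleton a
  rw [Set.biUnion_of_singleton] at h1
  rw [harmonicFunction, ofReal_measureReal, h1]
  exact tsum_congr fun ω => h.walkMeasure_singleton hr ω.2

end IsCycleFilter

/-! ### The measure `λ_C` -/

section PathCoordinates

variable {X : Type*} [MeasurableSpace X] {r : X → X}

theorem measurable_coord (n : ℕ) : Measurable fun ω : PathSpace r => ω.1 n :=
  (measurable_pi_apply n).comp measurable_subtype_coe

theorem measurable_start : Measurable (start (r := r)) := measurable_coord 0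

theorem measurable_shift (hr : Measurable r) : Measurable (shift (r := r)) := by
  refine Measurable.subtype_mk (measurable_pi_lambda _ fun n => ?_)
  cases n with
  | zero => exact hr.comp (measurable_coord 0)
  | succ n => exact measurable_coord n

/-- The inverse of the shift. -/
def unshift {X : Type*} {r : X → X} (ω : PathSpace r) : PathSpace r :=
  ⟨fun n => ω.1 (n + 1), fun n => ω.2 (n + 1)⟩

theorem measurable_unshift : Measurable (unshift (r := r)) :=
  Measurable.subtype_mk (measurable_pi_lambda _ fun n => measurable_coord (n + 1))

end PathCoordinates

theorem shift_unshift {X : Type*} {r : X → X} (ω : PathSpace r) : shift (unshift ω) = ω := by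
  refine Subtype.ext (funext fun n => ?_)
  cases n with
  | zero => exact ω.2 0
  | succ n => rfl

theorem unshift_shift {X : Type*} {r : X → X} (ω : PathSpace r) : unshift (shift ω) = ω := rfl

theorem start_shift {X : Type*} {r : X → X} (ω : PathSpace r) : start (shift ω) = r (start ω) := rfl

theorem sum_dirac_apply {Y : Type*} [MeasurableSpace Y] (S : Set Y) {s : Set Y}
    (hs : MeasurableSet s) :
    (Measure.sum fun y : S => Measure.dirac (y : Y)) s = ((S ∩ s).encard : ℝ≥0∞) := by
  rw [Measure.sum_apply _ hs]
  simp_rw [Measure.dirac_apply' _ hs]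
  rw [tsum_subtype S (s.indicator 1), Set.indicator_indicator, ← tsum_subtype]
  exact ENNReal.tsum_set_one _

/-- The counting measure on `N_C(x)`. -/
def pathKernel {X : Type*} [TopologicalSpace X] [MeasurableSpace X] (r : X → X) {p : ℕ}
    (c : ZMod p → X) (x : X) : Measure (PathSpace r) :=
  Measure.sum fun ω : cyclePaths r c x => Measure.dirac (ω : PathSpace r)

section PathKernel

variable {X : Type*} [TopologicalSpace X] [MeasurableSpace X] {r : X → X} {p : ℕ} {c : ZMod p → X}

theorem pathKernel_apply (x : X) {s : Set (PathSpace r)} (hs : MeasurableSet s) :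
    pathKernel r c x s = ((cyclePaths r c x ∩ s).encard : ℝ≥0∞) :=
  sum_dirac_apply _ hs

theorem lintegral_pathKernel [MeasurableSingletonClass X] (x : X)
    (F : PathSpace r → ℝ≥0∞) :
    ∫⁻ ω, F ω ∂(pathKernel r c x) = ∑' ω : cyclePaths r c x, F ω := by
  simp [pathKernel, lintegral_sum_measure, lintegral_dirac]

theorem measurableSet_follows {X : Type*} [MetricSpace X] [MeasurableSpace X] [BorelSpace X]
    [SecondCountableTopology X] {r : X → X} {p : ℕ} {c : ZMod p → X} (i : ZMod p) :
    MeasurableSet {ω : PathSpace r | Follows c ω i} :=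
  measurableSet_tendsto (𝓝 (c i)) fun k => measurable_coord (k * p)

end PathKernel

/-- The weight `α_{i(ω)} √#r⁻¹(r(z₀))` of the scaling operator. -/
def scalingWeight {X : Type*} [TopologicalSpace X] (r : X → X) {p : ℕ} (c : ZMod p → X) (α : ZMod p → ℂ) (ω : PathSpace r) : ℂ :=
  α (cycleIndex c ω) * (Real.sqrt (fibreCard r (r (start ω))) : ℂ)

section Weight

variable {X : Type*} [MetricSpace X] {r : X → X} {p : ℕ} {c : ZMod p → X} {α : ZMod p → ℂ}
  {m₀ : X → ℂ}

theorem IsCycleFilter.enorm_scalingWeight_sq (h : IsCycleFilter r c α m₀) (ω : PathSpace r) :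
    ‖scalingWeight r c α ω‖ₑ ^ 2 = (fibreCard r (r (start ω)) : ℝ≥0∞) := by
  rw [scalingWeight, ← ofReal_norm, norm_mul, h.norm_phase, one_mul, Complex.norm_real,
    Real.norm_of_nonneg (Real.sqrt_nonneg _), ← ENNReal.ofReal_pow (Real.sqrt_nonneg _),
    Real.sq_sqrt (Nat.cast_nonneg _), ENNReal.ofReal_natCast]

theorem IsCycleFilter.scalingWeight_ne_zero (h : IsCycleFilter r c α m₀) (ω : PathSpace r) :
    scalingWeight r c α ω ≠ 0 := by
  intro h0
  have h1 := h.enorm_scalingWeight_sq ω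
  rw [h0] at h1
  have h2 : fibreCard r (r (start ω)) = 0 := by simpa using h1.symm
  exact (h.card_pos _).ne' h2

end Weight

/-! ### Measurability of the path sums, and the change of variables under the shift -/

section Kernel

variable {X : Type*} [MetricSpace X] [CompactSpace X] [MeasurableSpace X] [BorelSpace X]
  {r : X → X} {p : ℕ} {c : ZMod p → X} {ρ : Measure X} {D : X → ℝ≥0∞}

theorem measurableSet_cyclePiece {V : ZMod p → Set X} (hV : ∀ i, IsOpen (V i)) (i : ZMod p)
    (K : ℕ) : MeasurableSet (cyclePiece (r := r) c V i K) := by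
  have h1 : MeasurableSet {ω : PathSpace r | ∀ n, K ≤ n → ω.1 n ∈ V (i + n)} := by
    rw [Set.ofPred_forall]
    refine MeasurableSet.iInter fun n => ?_
    by_cases hn : K ≤ n
    · simp only [hn, forall_true_left]
      exact measurable_coord n (hV _).measurableSet
    · simp [hn]
  exact (measurableSet_follows i).inter h1

/-- The coordinate `z_K` turns counting paths in `B ∩ s` from `x` into counting points of
`r^{-K}(x)` in the image of `B ∩ s`, which is Borel by the Lusin–Souslin theorem. -/
theorem FibreRegular.aemeasurable_sum_dirac (hreg : FibreRegular ρ r D) {B : Set (PathSpace r)}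
    (hB : MeasurableSet B) (K : ℕ) (hinj : Set.InjOn (fun ω : PathSpace r => ω.1 K) B) :
    AEMeasurable (fun x => Measure.sum fun ω : (B ∩ start ⁻¹' {x} : Set (PathSpace r)) =>
      Measure.dirac (ω : PathSpace r)) ρ := by
  have hstd : StandardBorelSpace (PathSpace r) :=
    (measurableSet_pathSpace hreg.measurable).standardBorel
  obtain ⟨D', hD'⟩ := hreg.iterate K
  have himg : ∀ x (s : Set (PathSpace r)), (B ∩ start ⁻¹' {x} ∩ s).encard =
      (r^[K] ⁻¹' {x} ∩ (fun ω : PathSpace r => ω.1 K) '' (B ∩ s)).encard := fun x s => by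
    rw [← (hinj.mono fun ω hω => hω.1.1 : Set.InjOn _ (B ∩ start ⁻¹' {x} ∩ s)).encard_image]
    congr 1
    ext z
    constructor
    · rintro ⟨ω, ⟨⟨hωB, hωx⟩, hωs⟩, rfl⟩
      exact ⟨(ω.iterate_start K).trans hωx, ω, ⟨hωB, hωs⟩, rfl⟩
    · rintro ⟨hz, ω, ⟨hωB, hωs⟩, rfl⟩
      exact ⟨ω, ⟨⟨hωB, (ω.iterate_start K).symm.trans hz⟩, hωs⟩, rfl⟩
  refine aemeasurable_measure_of_apply (fun x => ⟨?_⟩) fun s hs => ?_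
  · rw [sum_dirac_apply _ MeasurableSet.univ, himg]
    have := (hD'.finite x).inter_of_left ((fun ω : PathSpace r => ω.1 K) '' (B ∩ Set.univ))
    simpa using this
  · simp_rw [sum_dirac_apply _ hs, himg]
    have hm : MeasurableSet ((fun ω : PathSpace r => ω.1 K) '' (B ∩ s)) :=
      (hB.inter hs).image_of_measurable_injOn (measurable_coord K)
        (hinj.mono Set.inter_subset_left)
    refine (hD'.aemeasurable_fibreMeasure_apply hm.nullMeasurableSet).congr
      (Eventually.of_forall fun x => ?_)
    exact fibreMeasure_apply_of_finite (hD'.finite x) _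

variable [NeZero p] {α : ZMod p → ℂ} {m₀ : X → ℂ}

theorem IsCycleFilter.aemeasurable_pathKernel (h : IsCycleFilter r c α m₀)
    (hreg : FibreRegular ρ r D) : AEMeasurable (pathKernel r c) ρ := by
  obtain ⟨V, hVo, hVn, hVi⟩ := h.exists_nhds
  -- The pieces grow with `K`, so they are made disjoint for each `i`; for different `i` they are
  -- disjoint by uniqueness of the limit.
  let B : ZMod p × ℕ → Set (PathSpace r) := fun q => disjointed (cyclePiece c V q.1) q.2
  have hBsub : ∀ q, B q ⊆ cyclePiece c V q.1 q.2 := fun q => disjointed_subset _ _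
  have hBm : ∀ q, MeasurableSet (B q) := fun q =>
    MeasurableSet.disjointed (fun K => measurableSet_cyclePiece hVo q.1 K) q.2
  have hBinj : ∀ q, Set.InjOn (fun ω : PathSpace r => ω.1 q.2) (B q) := fun q =>
    (injOn_cyclePiece hVi q.1 q.2).mono (hBsub q)
  have hBdisj : ∀ {ω q q'}, ω ∈ B q → ω ∈ B q' → q = q' := by
    rintro ω ⟨i, K⟩ ⟨i', K'⟩ hq hq'
    obtain rfl : i = i' := h.follows_unique (hBsub _ hq).1 (hBsub _ hq').1
    by_contra hne
    have hKK : K ≠ K' := fun hK => hne (by rw [hK])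
    exact Set.disjoint_left.1 (disjoint_disjointed (cyclePiece (r := r) c V i) hKK) hq hq'
  have hBex : ∀ {ω i}, Follows c ω i → ∃ q, ω ∈ B q := by
    intro ω i hω
    obtain ⟨K, hK⟩ := h.exists_mem_cyclePiece hVn hω
    have h1 : ω ∈ ⋃ K, disjointed (cyclePiece c V i) K := by
      rw [iUnion_disjointed]
      exact Set.mem_iUnion.2 ⟨K, hK⟩
    obtain ⟨K', hK'⟩ := Set.mem_iUnion.1 h1
    exact ⟨(i, K'), hK'⟩
  have hsum : pathKernel r c = fun x => Measure.sum fun q =>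
      Measure.sum fun ω : (B q ∩ start ⁻¹' {x} : Set (PathSpace r)) =>
        Measure.dirac (ω : PathSpace r) := by
    funext x
    ext s hs
    rw [pathKernel, Measure.sum_apply _ hs, Measure.sum_apply _ hs]
    simp_rw [Measure.sum_apply _ hs]
    rw [tsum_subtype (cyclePaths r c x) fun ω => Measure.dirac ω s]
    simp_rw [fun q => tsum_subtype (B q ∩ start ⁻¹' {x}) fun ω => Measure.dirac ω s]
    rw [ENNReal.tsum_comm]
    refine tsum_congr fun ω => ?_
    by_cases hω : ω ∈ cyclePaths r c x
    · obtain ⟨i, hi⟩ := hω.2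
      obtain ⟨q, hq⟩ := hBex hi
      rw [tsum_eq_single q fun q' hq' => Set.indicator_of_notMem
        (fun hmem => hq' (hBdisj hmem.1 hq)) _, Set.indicator_of_mem hω,
        Set.indicator_of_mem (s := B q ∩ start ⁻¹' {x}) ⟨hq, hω.1⟩]
    · rw [Set.indicator_of_notMem hω]
      symm
      rw [ENNReal.tsum_eq_zero]
      exact fun q => Set.indicator_of_notMem
        (fun hmem => hω ⟨hmem.2, _, (hBsub q hmem.1).1⟩) _
  rw [hsum]
  exact aemeasurable_measure_sum fun q => hreg.aemeasurable_sum_dirac (hBm q) q.2 (hBinj q)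

/-- This is where a.e. measurability of the path kernel matters: `Measure.bind` is `0` for a family
that is not a.e. measurable. -/
theorem IsCycleFilter.lintegral_cycleMeasure (h : IsCycleFilter r c α m₀)
    (hreg : FibreRegular ρ r D) {F : PathSpace r → ℝ≥0∞}
    (hF : AEMeasurable F (cycleMeasure r ρ c)) :
    ∫⁻ ω, F ω ∂(cycleMeasure r ρ c) = ∫⁻ x, ∑' ω : cyclePaths r c x, F ω ∂ρ := by
  simp_rw [← lintegral_pathKernel]
  exact Measure.lintegral_bind (h.aemeasurable_pathKernel hreg) hF

theorem IsCycleFilter.aemeasurable_tsum (h : IsCycleFilter r c α m₀)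
    (hreg : FibreRegular ρ r D) {F : PathSpace r → ℝ≥0∞}
    (hF : AEMeasurable F (cycleMeasure r ρ c)) :
    AEMeasurable (fun x => ∑' ω : cyclePaths r c x, F ω) ρ := by
  simp_rw [← lintegral_pathKernel]
  exact (Measure.aemeasurable_lintegral hF).comp_aemeasurable (h.aemeasurable_pathKernel hreg)

theorem IsCycleFilter.ae_follows (h : IsCycleFilter r c α m₀) (hreg : FibreRegular ρ r D) :
    ∀ᵐ ω ∂(cycleMeasure r ρ c), Follows c ω (cycleIndex c ω) := by
  have hm : MeasurableSet {ω : PathSpace r | ∃ i, Follows c ω i} := by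
    rw [Set.ofPred_exists]
    exact MeasurableSet.iUnion fun i => measurableSet_follows i
  have h1 : ∀ᵐ ω ∂(cycleMeasure r ρ c), ∃ i, Follows c ω i := by
    rw [ae_iff]
    change (ρ.bind (pathKernel r c)) {ω : PathSpace r | ∃ i, Follows c ω i}ᶜ = 0
    rw [Measure.bind_apply hm.compl (h.aemeasurable_pathKernel hreg)]
    refine lintegral_eq_zero_of_ae_eq_zero (Eventually.of_forall fun x => ?_)
    change pathKernel r c x _ = 0
    rw [pathKernel_apply _ hm.compl]
    have : cyclePaths r c x ∩ {ω : PathSpace r | ∃ i, Follows c ω i}ᶜ = ∅ := by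
      ext ω
      simp only [Set.mem_inter_iff, Set.mem_empty_iff_false, iff_false, not_and]
      exact fun hω hc => hc hω.2
    simp [this]
  filter_upwards [h1] with ω ⟨i, hi⟩
  rw [h.cycleIndex_eq hi]
  exact hi

/-- The `n`-th coordinate of a path from `x` lies in `r^{-n}(x)`, and almost every such fibre misses
a given null set. -/
theorem IsCycleFilter.quasiMeasurePreserving_coord (h : IsCycleFilter r c α m₀)
    (hreg : FibreRegular ρ r D) (n : ℕ) :
    Measure.QuasiMeasurePreserving (fun ω : PathSpace r => ω.1 n) (cycleMeasure r ρ c) ρ := by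
  refine ⟨measurable_coord n, Measure.AbsolutelyContinuous.mk fun s hs h0 => ?_⟩
  obtain ⟨D', hD'⟩ := hreg.iterate n
  rw [Measure.map_apply (measurable_coord n) hs]
  change (ρ.bind (pathKernel r c)) _ = 0
  rw [Measure.bind_apply (measurable_coord n hs) (h.aemeasurable_pathKernel hreg)]
  refine lintegral_eq_zero_of_ae_eq_zero ?_
  filter_upwards [hD'.ae_fibre (measure_eq_zero_iff_ae_notMem.1 h0)] with x hx
  rw [pathKernel_apply _ (measurable_coord n hs)]
  have : cyclePaths r c x ∩ (fun ω : PathSpace r => ω.1 n) ⁻¹' s = ∅ := by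
    ext ω
    simp only [Set.mem_inter_iff, Set.mem_empty_iff_false, iff_false, not_and]
    exact fun hω => hx _ ((ω.iterate_start n).trans hω.1)
  simp [this]

theorem IsCycleFilter.measurable_comp_cycleIndex (h : IsCycleFilter r c α m₀) (g : ZMod p → ℂ) :
    Measurable fun ω : PathSpace r => g (cycleIndex c ω) := by
  have hm : ∀ i, MeasurableSet {ω : PathSpace r | cycleIndex c ω = i} := fun i => by
    -- The second set accounts for the default index `0` of paths that do not converge to the cycle.
    have : {ω : PathSpace r | cycleIndex c ω = i} = {ω | Follows c ω i} ∪
        ({ω | ∃ j, Follows c ω j}ᶜ ∩ {_ω | i = 0}) := by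
      ext ω
      simp only [Set.mem_ofPred_eq, Set.mem_union, Set.mem_inter_iff, Set.mem_compl_iff]
      by_cases hω : ∃ j, Follows c ω j
      · obtain ⟨j, hj⟩ := hω
        rw [h.cycleIndex_eq hj]
        constructor
        · rintro rfl; exact Or.inl hj
        · rintro (hi | hi)
          · exact h.follows_unique hj hi
          · exact absurd ⟨j, hj⟩ hi.1
      · have h0 : cycleIndex c ω = 0 := dif_neg hω
        rw [h0]
        constructor
        · intro hi; exact Or.inr ⟨hω, hi.symm⟩
        · rintro (hi | hi)
          · exact absurd ⟨i, hi⟩ hω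
          · exact hi.2.symm
    rw [this]
    refine (measurableSet_follows i).union (MeasurableSet.inter ?_ (MeasurableSet.const _))
    rw [Set.ofPred_exists]
    exact (MeasurableSet.iUnion fun i => measurableSet_follows i).compl
  have : (fun ω : PathSpace r => g (cycleIndex c ω)) = fun ω => ∑ i : ZMod p,
      {ω : PathSpace r | cycleIndex c ω = i}.indicator (fun _ => g i) ω := by
    funext ω
    rw [Finset.sum_eq_single (cycleIndex c ω)]
    · simp
    · intro i _ hi
      exact Set.indicator_of_notMem (fun hmem => hi (Eq.symm hmem)) _
    · simp
  rw [this]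
  exact Finset.measurable_fun_sum _ fun i _ => measurable_const.indicator (hm i)

theorem IsCycleFilter.aemeasurable_scalingFunction (h : IsCycleFilter r c α m₀)
    (hreg : FibreRegular ρ r fun x => (fibreCard r (r x) : ℝ≥0∞)) (hm₀ : AEMeasurable m₀ ρ) :
    AEMeasurable (scalingFunction r c α m₀) (cycleMeasure r ρ c) := by
  have hfac : ∀ k : ℕ, AEMeasurable (fun ω : PathSpace r =>
      (α (cycleIndex c ω + ((k + 1 : ℕ) : ZMod p)))⁻¹ * m₀ (ω.1 (k + 1)) /
      (Real.sqrt (fibreCard r (r (ω.1 (k + 1)))) : ℂ)) (cycleMeasure r ρ c) := fun k => by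
    have hq := h.quasiMeasurePreserving_coord hreg (k + 1)
    have h1 := (h.measurable_comp_cycleIndex fun i => α (i + ((k + 1 : ℕ) : ZMod p))).inv
    have h2 := hm₀.comp_quasiMeasurePreserving hq
    have h3 := hreg.aemeasurable_weight.comp_quasiMeasurePreserving hq
    have h4 := Complex.measurable_ofReal.comp_aemeasurable h3.ennreal_toReal.sqrt
    refine (h1.aemeasurable.mul h2).div (h4.congr (Eventually.of_forall fun ω => ?_))
    simp
  refine aemeasurable_of_tendsto_metrizable_ae atTop (fun n : ℕ =>
    Finset.aemeasurable_fun_prod (Finset.range n) fun k _ => hfac k) ?_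
  filter_upwards [h.ae_follows hreg] with ω hω
  exact (h.multipliable_factor hω).hasProd.tendsto_prod_nat

theorem IsCycleFilter.aemeasurable_harmonicFunction (h : IsCycleFilter r c α m₀)
    (hreg : FibreRegular ρ r fun x => (fibreCard r (r x) : ℝ≥0∞)) (hm₀ : AEMeasurable m₀ ρ) :
    AEMeasurable (fun x => ENNReal.ofReal (harmonicFunction r c m₀ x)) ρ := by
  simp_rw [h.ofReal_harmonicFunction hreg.measurable]
  exact h.aemeasurable_tsum hreg ((h.aemeasurable_scalingFunction hreg hm₀).enorm.pow_const 2)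

/-- Integrated over the starting point, the identity for `h_C` says exactly that `ξ ↦ φ̂ · (ξ ∘ θ₀)`
is isometric on `L²(h_C ρ)`. -/
theorem IsCycleFilter.map_start (h : IsCycleFilter r c α m₀)
    (hreg : FibreRegular ρ r fun x => (fibreCard r (r x) : ℝ≥0∞)) (hm₀ : AEMeasurable m₀ ρ) :
    ((cycleMeasure r ρ c).withDensity fun ω => ‖scalingFunction r c α m₀ ω‖ₑ ^ 2).map start =
      ρ.withDensity fun x => ENNReal.ofReal (harmonicFunction r c m₀ x) := by
  ext s hs
  have hφ := (h.aemeasurable_scalingFunction hreg hm₀).enorm.pow_const 2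
  rw [Measure.map_apply measurable_start hs, withDensity_apply _ (measurable_start hs),
    withDensity_apply _ hs, ← lintegral_indicator (measurable_start hs), ← lintegral_indicator hs,
    h.lintegral_cycleMeasure hreg (hφ.indicator (measurable_start hs))]
  refine lintegral_congr fun x => ?_
  by_cases hx : x ∈ s
  · rw [Set.indicator_of_mem hx, h.ofReal_harmonicFunction hreg.measurable]
    refine tsum_congr fun ω => Set.indicator_of_mem ?_ _
    rw [Set.mem_preimage, ω.2.1]
    exact hx
  · rw [Set.indicator_of_notMem hx, ENNReal.tsum_eq_zero]
    refine fun ω => Set.indicator_of_notMem ?_ _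
    rw [Set.mem_preimage, ω.2.1]
    exact hx

theorem IsCycleFilter.memLp_scalingFunction [IsProbabilityMeasure ρ] (h : IsCycleFilter r c α m₀)
    (hreg : FibreRegular ρ r fun x => (fibreCard r (r x) : ℝ≥0∞)) (hm₀ : AEMeasurable m₀ ρ) :
    MemLp (scalingFunction r c α m₀) 2 (cycleMeasure r ρ c) := by
  have hφ := h.aemeasurable_scalingFunction hreg hm₀
  refine ⟨hφ.aestronglyMeasurable, ?_⟩
  rw [eLpNorm_two_eq]
  refine ENNReal.rpow_lt_top_of_nonneg (by norm_num) (ne_top_of_le_ne_top ENNReal.one_ne_top ?_)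
  rw [h.lintegral_cycleMeasure hreg (hφ.enorm.pow_const 2)]
  simp_rw [← h.ofReal_harmonicFunction hreg.measurable]
  calc ∫⁻ x, ENNReal.ofReal (harmonicFunction r c m₀ x) ∂ρ ≤ ∫⁻ _, 1 ∂ρ :=
        lintegral_mono fun x => harmonicFunction_le_one c m₀ hreg.measurable x
    _ = 1 := by simp

/-- The shift is a bijection of the disjoint union of the `N_C(y)`, `r(y) = x`, onto `N_C(x)`. -/
def IsCycleFilter.shiftEquiv (h : IsCycleFilter r c α m₀) (x : X) :
    (Σ y : r ⁻¹' {x}, cyclePaths r c (y : X)) ≃ cyclePaths r c x where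
  toFun a := ⟨shift (a.2 : PathSpace r), by
    obtain ⟨i, hi⟩ := a.2.2.2
    refine ⟨?_, i - 1, h.follows_shift hi⟩
    rw [start_shift, a.2.2.1]
    exact a.1.2⟩
  invFun ω := ⟨⟨start (unshift (ω : PathSpace r)), (ω.1.2 0).trans ω.2.1⟩,
    ⟨unshift ω, rfl, by
      obtain ⟨i, hi⟩ := ω.2.2
      refine ⟨i + 1, h.follows_of_shift ?_⟩
      rw [shift_unshift]
      exact hi⟩⟩
  left_inv := by
    rintro ⟨⟨y, hy⟩, ⟨ω, hω⟩⟩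
    have hωy : start ω = y := hω.1
    subst hωy
    rfl
  right_inv ω := Subtype.ext (shift_unshift _)

/-- Fibre regularity turns the factor `D` into a sum over `y ∈ r⁻¹(x)`; the shift then merges the
sums over the `N_C(y)` into one over `N_C(x)`. -/
theorem IsCycleFilter.lintegral_comp_shift (h : IsCycleFilter r c α m₀)
    (hreg : FibreRegular ρ r D) {F : PathSpace r → ℝ≥0∞} (hF : AEMeasurable F (cycleMeasure r ρ c))
    (hFs : AEMeasurable (fun ω => F (shift ω)) (cycleMeasure r ρ c)) :
    ∫⁻ ω, D (start ω) * F (shift ω) ∂(cycleMeasure r ρ c) = ∫⁻ ω, F ω ∂(cycleMeasure r ρ c) := by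
  have hD : AEMeasurable (fun ω : PathSpace r => D (start ω)) (cycleMeasure r ρ c) :=
    hreg.aemeasurable_weight.comp_quasiMeasurePreserving (h.quasiMeasurePreserving_coord hreg 0)
  rw [h.lintegral_cycleMeasure hreg (F := fun ω => D (start ω) * F (shift ω)) (hD.mul hFs),
    h.lintegral_cycleMeasure hreg hF]
  have h1 : ∀ x, ∑' ω : cyclePaths r c x, D (start (ω : PathSpace r)) * F (shift (ω : PathSpace r)) =
      D x * ∑' ω : cyclePaths r c x, F (shift (ω : PathSpace r)) := fun x => by
    rw [← ENNReal.tsum_mul_left]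
    exact tsum_congr fun ω => by rw [ω.2.1]
  simp_rw [h1]
  rw [← hreg.lintegral_fibre (h.aemeasurable_tsum hreg hFs)]
  refine lintegral_congr fun x => ?_
  rw [lintegral_fibreMeasure, ← ENNReal.tsum_sigma' (fun a :
    (Σ y : r ⁻¹' {x}, cyclePaths r c (y : X)) => F (shift (a.2 : PathSpace r)))]
  exact (h.shiftEquiv x).tsum_eq fun ω : cyclePaths r c x => F ω

theorem IsCycleFilter.aemeasurable_scalingWeight (h : IsCycleFilter r c α m₀)
    (hreg : FibreRegular ρ r fun x => (fibreCard r (r x) : ℝ≥0∞)) :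
    AEMeasurable (scalingWeight r c α) (cycleMeasure r ρ c) := by
  have h3 := hreg.aemeasurable_weight.comp_quasiMeasurePreserving
    (h.quasiMeasurePreserving_coord hreg 0)
  have h4 := Complex.measurable_ofReal.comp_aemeasurable h3.ennreal_toReal.sqrt
  refine (h.measurable_comp_cycleIndex α).aemeasurable.mul
    (h4.congr (Eventually.of_forall fun ω => ?_))
  simp [start]

theorem IsCycleFilter.map_shift (h : IsCycleFilter r c α m₀)
    (hreg : FibreRegular ρ r fun x => (fibreCard r (r x) : ℝ≥0∞)) :
    ((cycleMeasure r ρ c).withDensity fun ω => ‖scalingWeight r c α ω‖ₑ ^ 2).map shift =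
      cycleMeasure r ρ c := by
  have hsh := measurable_shift hreg.measurable
  ext s hs
  have hF : Measurable (s.indicator (1 : PathSpace r → ℝ≥0∞)) := measurable_one.indicator hs
  rw [Measure.map_apply hsh hs, withDensity_apply _ (hsh hs), ← lintegral_indicator (hsh hs),
    ← lintegral_indicator_one hs,
    ← h.lintegral_comp_shift hreg hF.aemeasurable (hF.comp hsh).aemeasurable]
  refine lintegral_congr fun ω => ?_
  by_cases hω : shift ω ∈ s
  · rw [Set.indicator_of_mem (show ω ∈ shift ⁻¹' s from hω), Set.indicator_of_mem hω,
      h.enorm_scalingWeight_sq, Pi.one_apply, mul_one]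
  · rw [Set.indicator_of_notMem (show ω ∉ shift ⁻¹' s from hω), Set.indicator_of_notMem hω,
      mul_zero]

theorem IsCycleFilter.map_unshift (h : IsCycleFilter r c α m₀)
    (hreg : FibreRegular ρ r fun x => (fibreCard r (r x) : ℝ≥0∞)) :
    ((cycleMeasure r ρ c).withDensity fun ω =>
      ‖(scalingWeight r c α (unshift ω))⁻¹‖ₑ ^ 2).map unshift = cycleMeasure r ρ c := by
  have hsh := measurable_shift hreg.measurable
  have hw : ∀ ω : PathSpace r, ‖(scalingWeight r c α (unshift ω))⁻¹‖ₑ ^ 2 =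
      (fibreCard r (r (ω.1 1)) : ℝ≥0∞)⁻¹ := fun ω => by
    rw [enorm_inv (h.scalingWeight_ne_zero _), ← ENNReal.inv_pow, h.enorm_scalingWeight_sq]
    rfl
  simp_rw [hw]
  have hD : ∀ n, AEMeasurable (fun ω : PathSpace r => (fibreCard r (r (ω.1 n)) : ℝ≥0∞)⁻¹)
      (cycleMeasure r ρ c) := fun n =>
    (hreg.aemeasurable_weight.comp_quasiMeasurePreserving
      (h.quasiMeasurePreserving_coord hreg n)).inv
  ext s hs
  have hu : MeasurableSet (unshift (r := r) ⁻¹' s) := measurable_unshift hs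
  have hF := (hD 1).indicator hu
  have hFs : AEMeasurable (fun ω : PathSpace r => (unshift (r := r) ⁻¹' s).indicator
      (fun ω => (fibreCard r (r (ω.1 1)) : ℝ≥0∞)⁻¹) (shift ω)) (cycleMeasure r ρ c) := by
    exact (hD 0).indicator hs
  -- The shift formula is applied to a function carrying `1 / #r⁻¹(r(z₁))`; after the shift, `z₁`
  -- becomes `z₀` and this cancels the Jacobian.
  rw [Measure.map_apply measurable_unshift hs, withDensity_apply _ hu, ← lintegral_indicator hu,
    ← h.lintegral_comp_shift hreg hF hFs, ← lintegral_indicator_one hs]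
  refine lintegral_congr fun ω => ?_
  have h0 : (fibreCard r (r (start ω)) : ℝ≥0∞) ≠ 0 := by exact_mod_cast (h.card_pos _).ne'
  by_cases hω : ω ∈ s
  · rw [Set.indicator_of_mem hω,
      Set.indicator_of_mem (show shift ω ∈ unshift (r := r) ⁻¹' s from hω)]
    exact ENNReal.mul_inv_cancel h0 (ENNReal.natCast_ne_top _)
  · rw [Set.indicator_of_notMem hω,
      Set.indicator_of_notMem (show shift ω ∉ unshift (r := r) ⁻¹' s from hω), mul_zero]

end Kernel

/-! ### The scaling operator and the core space -/

section Multiplication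

variable {X : Type*} [MeasurableSpace X] {ρ μ : Measure X}

theorem memLp_top_of_absolutelyContinuous (hμ : μ ≪ ρ) (f : Lp ℂ ∞ ρ) : MemLp f ∞ μ := by
  refine ⟨(Lp.aestronglyMeasurable f).mono_ac hμ, ?_⟩
  have h := (Lp.memLp f).2
  rw [eLpNorm_exponent_top] at h ⊢
  exact (eLpNormEssSup_mono_measure _ hμ).trans_lt h

theorem exists_mul (hμ : μ ≪ ρ) (f : Lp ℂ ∞ ρ) (ξ : Lp ℂ 2 μ) :
    ∃ η : Lp ℂ 2 μ, η =ᵐ[μ] fun x => f x * ξ x := by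
  have hf := memLp_top_of_absolutelyContinuous hμ f
  refine ⟨(ContinuousLinearMap.mul ℂ ℂ).holder 2 hf.toLp ξ, ?_⟩
  filter_upwards [(ContinuousLinearMap.mul ℂ ℂ).coeFn_holder (r := 2) hf.toLp ξ,
    hf.coeFn_toLp] with x h1 h2
  rw [h1, h2]
  rfl

theorem exists_comp {q : X → X} (hq : Measure.QuasiMeasurePreserving q ρ ρ) (f : Lp ℂ ∞ ρ) :
    ∃ f' : Lp ℂ ∞ ρ, f' =ᵐ[ρ] fun x => f (q x) := by
  have h1 : MemLp f ∞ (ρ.map q) := memLp_top_of_absolutelyContinuous hq.absolutelyContinuous f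
  have h2 : MemLp (fun x => f (q x)) ∞ ρ := h1.comp_of_map hq.measurable.aemeasurable
  exact ⟨h2.toLp, h2.coeFn_toLp⟩

theorem isMultiplicityFunction_restrictRep [StandardBorelSpace X] [IsFiniteMeasure ρ]
    {q : X → X} {D h : X → ℝ≥0∞} (hreg : FibreRegular ρ q D) (hh : AEMeasurable h ρ)
    (hμ : μ = ρ.withDensity h) [IsFiniteMeasure μ] {H : Type*}
    [NormedAddCommGroup H] [InnerProductSpace ℂ H] (π : Lp ℂ ∞ ρ → H →L[ℂ] H)
    (S : Lp ℂ 2 μ →ₗᵢ[ℂ] H)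
    (hS : ∀ f ξ, ∃ η : Lp ℂ 2 μ, η =ᵐ[μ] (fun z => f (q z) * ξ z) ∧ π f (S ξ) = S η)
    {V : Submodule ℂ H} (hVS : V = LinearMap.range S.toLinearMap) :
    ∃ hV : IsInvariant π V, IsMultiplicityFunction ρ (restrictRep π V hV)
      fun x => (q ⁻¹' {x} ∩ {z | h z ≠ 0}).encard := by
  subst hVS
  have hV : IsInvariant π (LinearMap.range S.toLinearMap) := by
    rintro f _ ⟨ξ, rfl⟩
    obtain ⟨η, -, hη⟩ := hS f ξ
    exact ⟨η, hη.symm⟩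
  refine ⟨hV, isMultiplicityFunction_of_comp hreg hh hμ _ S.equivRange fun f ξ => ?_⟩
  obtain ⟨η, hη, hη'⟩ := hS f ξ
  have : restrictRep π _ hV f (S.equivRange ξ) = S.equivRange η := Subtype.ext hη'
  rw [this, LinearIsometryEquiv.symm_apply_apply]
  exact hη

end Multiplication

/-! ### The core space and the covariance relation -/

section Representation

variable {X : Type*} [TopologicalSpace X] [MeasurableSpace X] {r : X → X} {ρ : Measure X} {p : ℕ}
  {c : ZMod p → X}

theorem coeFn_rep (f : Lp ℂ ∞ ρ) (ξ : CycleL2 r ρ c) :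
    rep r ρ c f ξ =ᵐ[cycleMeasure r ρ c] fun ω => f (start ω) * ξ ω := by
  have h0 : pullback r ρ c f =ᵐ[cycleMeasure r ρ c] fun ω => f (start ω) := MemLp.coeFn_toLp _
  filter_upwards [(ContinuousLinearMap.mul ℂ ℂ).coeFn_holder (r := 2) (pullback r ρ c f) ξ,
    h0] with ω h1 h2
  rw [← h2]
  exact h1

variable {μ : Measure X} {φ : CycleL2 r ρ c} {T : Lp ℂ 2 μ →ₗᵢ[ℂ] CycleL2 r ρ c}

theorem rep_comp_start (hT : ∀ (ξ : Lp ℂ 2 μ) (g : X → ℂ), ξ =ᵐ[μ] g →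
      T ξ =ᵐ[cycleMeasure r ρ c] fun ω => φ ω * g (start ω))
    {f : Lp ℂ ∞ ρ} {ξ η : Lp ℂ 2 μ} (hη : η =ᵐ[μ] fun z => f z * ξ z) :
    rep r ρ c f (T ξ) = T η := by
  refine Lp.ext ?_
  filter_upwards [coeFn_rep f (T ξ), hT ξ ξ (ae_eq_refl _), hT η _ hη] with ω h1 h2 h3
  rw [h1, h2, h3]
  ring

/-- `V₀` is the range of the isometry `ξ ↦ φ · (ξ ∘ θ₀)`. -/
theorem coreSpace_eq_range [IsFiniteMeasure ρ] [IsFiniteMeasure μ] (hμ : μ ≪ ρ)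
    (hT : ∀ (ξ : Lp ℂ 2 μ) (g : X → ℂ), ξ =ᵐ[μ] g →
      T ξ =ᵐ[cycleMeasure r ρ c] fun ω => φ ω * g (start ω)) :
    coreSpace r ρ c φ = LinearMap.range T.toLinearMap := by
  have hrep : ∀ (f : Lp ℂ ∞ ρ) (ξ : Lp ℂ 2 μ), ξ =ᵐ[μ] f → rep r ρ c f φ = T ξ := fun f ξ hξ => by
    refine Lp.ext ?_
    filter_upwards [coeFn_rep f φ, hT ξ _ hξ] with ω h1 h2
    rw [h1, h2, mul_comm]
  refine le_antisymm ?_ ?_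
  · refine Submodule.topologicalClosure_minimal _ (Submodule.span_le.2 ?_) ?_
    · rintro _ ⟨f, rfl⟩
      have hf : MemLp f 2 μ := (memLp_top_of_absolutelyContinuous hμ f).mono_exponent le_top
      exact ⟨hf.toLp, (hrep f _ hf.coeFn_toLp).symm⟩
    · exact T.isometry.isClosedEmbedding.isClosed_range
  · rintro _ ⟨ξ, rfl⟩
    have hcl : IsClosed (coreSpace r ρ c φ : Set (CycleL2 r ρ c)) :=
      Submodule.isClosed_topologicalClosure _
    -- Indicators of finite `μ`-measure come from `L^∞(ρ)`, where `T` is `π(f) φ`; density and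
    -- closedness give the rest.
    refine Lp.induction (p := 2) (by norm_num) (fun ξ => T ξ ∈ coreSpace r ρ c φ) ?_ ?_ ?_ ξ
    · intro b s hs hμs
      change T (indicatorConstLp 2 hs hμs.ne b) ∈ _
      have h1 : indicatorConstLp 2 hs hμs.ne b =ᵐ[μ]
          indicatorConstLp ∞ hs (measure_ne_top ρ s) b :=
        indicatorConstLp_coeFn.trans (hμ.ae_eq indicatorConstLp_coeFn.symm)
      rw [← hrep _ _ h1]
      exact Submodule.le_topologicalClosure _ (Submodule.subset_span ⟨_, rfl⟩)
    · intro f g hf hg _ h1 h2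
      rw [map_add]
      exact add_mem h1 h2
    · exact hcl.preimage T.continuous

/-- Each `U⁻¹` moved across `π(f)` replaces `f` by `f ∘ r`. -/
theorem exists_rep_pow (hq : Measure.QuasiMeasurePreserving r ρ ρ)
    {U : CycleL2 r ρ c ≃ₗᵢ[ℂ] CycleL2 r ρ c}
    (hU : ∀ (f f' : Lp ℂ ∞ ρ) (ξ : CycleL2 r ρ c), f' =ᵐ[ρ] (fun x => f (r x)) →
      U (rep r ρ c f ξ) = rep r ρ c f' (U ξ)) (n : ℕ) (f : Lp ℂ ∞ ρ) :
    ∃ f' : Lp ℂ ∞ ρ, f' =ᵐ[ρ] (fun x => f (r^[n] x)) ∧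
      ∀ ξ, rep r ρ c f ((U⁻¹ ^ n) ξ) = (U⁻¹ ^ n) (rep r ρ c f' ξ) := by
  induction n with
  | zero => exact ⟨f, ae_eq_refl _, fun ξ => rfl⟩
  | succ n ih =>
    obtain ⟨g, hg, hg'⟩ := ih
    obtain ⟨g', hgg'⟩ := exists_comp hq g
    refine ⟨g', ?_, fun ξ => ?_⟩
    · filter_upwards [hgg', hq.ae hg] with x h1 h2
      rw [h1, h2, Function.iterate_succ_apply]
    · have h1 : rep r ρ c g (U⁻¹ ξ) = U⁻¹ (rep r ρ c g' ξ) := by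
        apply U.injective
        rw [hU g g' _ hgg']
        exact (congrArg _ (U.apply_symm_apply ξ)).trans (U.apply_symm_apply _).symm
      rw [pow_succ]
      change rep r ρ c f ((U⁻¹ ^ n) (U⁻¹ ξ)) = (U⁻¹ ^ n) (U⁻¹ (rep r ρ c g' ξ))
      rw [hg', h1]

theorem rep_comp_shift {α : ZMod p → ℂ}
    {U : CycleL2 r ρ c ≃ₗᵢ[ℂ] CycleL2 r ρ c}
    (hU : ∀ (ξ : CycleL2 r ρ c) (g : PathSpace r → ℂ), ξ =ᵐ[cycleMeasure r ρ c] g →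
      U ξ =ᵐ[cycleMeasure r ρ c] fun ω => scalingWeight r c α ω * g (shift ω))
    {f f' : Lp ℂ ∞ ρ} (hf : f' =ᵐ[ρ] fun x => f (r x)) (ξ : CycleL2 r ρ c) :
    U (rep r ρ c f ξ) = rep r ρ c f' (U ξ) := by
  refine Lp.ext ?_
  filter_upwards [hU _ _ (coeFn_rep f ξ), coeFn_rep f' (U ξ), hU ξ ξ (ae_eq_refl _),
    (start_quasiMeasurePreserving r ρ c).ae hf] with ω h1 h2 h3 h4
  rw [h1, h2, h3, h4, start_shift]
  ring

end Representation

/-! ### Unitarity of the scaling operator -/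

section Scaling

variable {X : Type*} [MetricSpace X] [CompactSpace X] [MeasurableSpace X] [BorelSpace X]
  {r : X → X} {p : ℕ} [NeZero p] {c : ZMod p → X} {α : ZMod p → ℂ} {m₀ : X → ℂ} {ρ : Measure X}

theorem IsCycleFilter.exists_scalingOperator (h : IsCycleFilter r c α m₀)
    (hreg : FibreRegular ρ r fun x => (fibreCard r (r x) : ℝ≥0∞)) :
    ∃ U : CycleL2 r ρ c ≃ₗᵢ[ℂ] CycleL2 r ρ c, ∀ (ξ : CycleL2 r ρ c) (g : PathSpace r → ℂ),
      ξ =ᵐ[cycleMeasure r ρ c] g →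
        U ξ =ᵐ[cycleMeasure r ρ c] fun ω => scalingWeight r c α ω * g (shift ω) := by
  have hw : AEMeasurable (fun ω : PathSpace r => (scalingWeight r c α (unshift ω))⁻¹)
      (cycleMeasure r ρ c) := by
    have h1 := (h.measurable_comp_cycleIndex α).comp (measurable_unshift (r := r))
    have h3 := hreg.aemeasurable_weight.comp_quasiMeasurePreserving
      (h.quasiMeasurePreserving_coord hreg 1)
    have h4 := Complex.measurable_ofReal.comp_aemeasurable h3.ennreal_toReal.sqrt
    refine (h1.aemeasurable.mul (h4.congr (Eventually.of_forall fun ω => ?_))).inv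
    simp [start, unshift]
  obtain ⟨V, hV⟩ := exists_weightedComp (measurable_shift hreg.measurable)
    (h.aemeasurable_scalingWeight hreg).aestronglyMeasurable (h.map_shift hreg)
  obtain ⟨V', hV'⟩ := exists_weightedComp measurable_unshift hw.aestronglyMeasurable
    (h.map_unshift hreg)
  -- The weighted composition with the inverse shift is a right inverse, so the isometry `V` is
  -- onto.
  have hVV' : ∀ η, V (V' η) = η := fun η => Lp.ext <| by
    filter_upwards [hV _ _ (hV' η η (ae_eq_refl _))] with ω hω
    rw [hω, unshift_shift, mul_inv_cancel_left₀ (h.scalingWeight_ne_zero ω)]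
  exact ⟨LinearIsometryEquiv.ofSurjective V fun η => ⟨_, hVV' η⟩, hV⟩

end Scaling

end CycleRep

end

theorem mainTheorem7 {X : Type*} [MetricSpace X] [CompactSpace X] [MeasurableSpace X]
    [BorelSpace X]
    (r : X → X) (hr : Measurable r) (hr_surj : Function.Surjective r)
    (hr_fin : ∀ x, (r ⁻¹' {x}).Finite)
    (ρ : Measure X) [IsProbabilityMeasure ρ] (hρ : CycleRep.StronglyInvariant r ρ)
    {p : ℕ} [NeZero p] (c : ZMod p → X) (hc : CycleRep.IsCycle r c)
    (hc_rep : CycleRep.IsRepellingCycle r c)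
    (hr_cont : ∀ i, ContinuousAt r (c i))
    (hcard_cont : ∀ i, ContinuousAt (CycleRep.fibreCard r) (c i))
    (α : ZMod p → ℂ) (hα : ∀ i, ‖α i‖ = 1)
    (m₀ : X → ℂ) (hm₀ : MemLp m₀ ∞ ρ)
    (hm₀_lip : ∀ i, CycleRep.IsBetaLipschitzAt m₀ (c i))
    (hm₀_qmf : ∀ x, (1 / (CycleRep.fibreCard r x : ℝ)) * ∑ᶠ y ∈ r ⁻¹' {x}, ‖m₀ y‖ ^ 2 = 1)
    (hm₀_low : ∀ i, m₀ (c i) = α i * (Real.sqrt (CycleRep.fibreCard r (r (c i))) : ℂ)) :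
    ∃ (hφ : MemLp (CycleRep.scalingFunction r c α m₀) 2 (CycleRep.cycleMeasure r ρ c))
      (U : CycleRep.CycleL2 r ρ c ≃ₗᵢ[ℂ] CycleRep.CycleL2 r ρ c),
      CycleRep.IsScalingOperator r ρ c α U ∧
      ∀ n : ℕ, ∃ hV : CycleRep.IsInvariant (CycleRep.rep r ρ c)
          (CycleRep.scaledSpace U n (CycleRep.coreSpace r ρ c hφ.toLp)),
        CycleRep.IsMultiplicityFunction ρ (CycleRep.restrictRep (CycleRep.rep r ρ c) _ hV)
          (fun x => ({z | r^[n] z = x} ∩ {z | CycleRep.harmonicFunction r c m₀ z ≠ 0}).encard) ∧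
        ∀ d : X → ℕ∞,
          CycleRep.IsMultiplicityFunction ρ (CycleRep.restrictRep (CycleRep.rep r ρ c) _ hV) d →
          ∀ᵐ x ∂ρ, d x =
            ({z | r^[n] z = x} ∩ {z | CycleRep.harmonicFunction r c m₀ z ≠ 0}).encard := by
  have h : CycleRep.IsCycleFilter r c α m₀ := ⟨hr_surj, hr_fin, hc, hc_rep, hr_cont, hcard_cont,
    hα, hm₀_lip, hm₀_qmf, hm₀_low⟩
  have hreg := hρ.fibreRegular hr hr_surj hr_fin
  have hm := hm₀.aestronglyMeasurable.aemeasurable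
  have hφ := h.memLp_scalingFunction hreg hm
  have hle := CycleRep.harmonicFunction_le_one (r := r) c m₀ hr
  obtain ⟨U, hU⟩ := h.exists_scalingOperator hreg
  refine ⟨hφ, U, fun ξ => hU ξ ξ (ae_eq_refl _), fun n => ?_⟩
  let κ : X → ℝ≥0∞ := fun x => ENNReal.ofReal (CycleRep.harmonicFunction r c m₀ x)
  have hκ : {z | κ z ≠ 0} = {z | CycleRep.harmonicFunction r c m₀ z ≠ 0} := by
    ext z
    have h0 : 0 ≤ CycleRep.harmonicFunction r c m₀ z := measureReal_nonneg
    simpa [κ] using h0.lt_iff_ne'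
  have hfin : IsFiniteMeasure (ρ.withDensity κ) :=
    isFiniteMeasure_withDensity (ne_top_of_le_ne_top ENNReal.one_ne_top <|
      (lintegral_mono hle).trans (by simp))
  have hac : ρ.withDensity κ ≪ ρ := withDensity_absolutelyContinuous _ _
  obtain ⟨T, hT'⟩ := CycleRep.exists_weightedComp CycleRep.measurable_start
    hφ.aestronglyMeasurable (h.map_start hreg hm)
  have hT : ∀ (ξ : Lp ℂ 2 (ρ.withDensity κ)) (g : X → ℂ), ξ =ᵐ[ρ.withDensity κ] g →
      T ξ =ᵐ[CycleRep.cycleMeasure r ρ c] fun ω => hφ.toLp (CycleRep.scalingFunction r c α m₀) ω * g (CycleRep.start ω) :=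
    fun ξ g hg => by
      filter_upwards [hT' ξ g hg, hφ.coeFn_toLp] with ω h1 h2
      rw [h1, h2]
  obtain ⟨D, hD⟩ := hreg.iterate n
  -- The space `U⁻ⁿ V₀` is the range of `U⁻ⁿ ∘ T` on `L²(h_C ρ)`, and `π(f)` acts there as
  -- multiplication by `f ∘ rⁿ`; so the fibre count applies with `q = rⁿ` and density `h_C`.
  obtain ⟨hV, hmult⟩ := CycleRep.isMultiplicityFunction_restrictRep hD
    (h.aemeasurable_harmonicFunction hreg hm) rfl (CycleRep.rep r ρ c)
    ((U⁻¹ ^ n).toLinearIsometry.comp T) (fun f ξ => by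
      obtain ⟨f', hf', hU'⟩ := CycleRep.exists_rep_pow hreg.quasiMeasurePreserving
        (fun _ _ ξ hf => CycleRep.rep_comp_shift hU hf ξ) n f
      obtain ⟨η, hη⟩ := CycleRep.exists_mul hac f' ξ
      refine ⟨η, ?_, (hU' _).trans (congrArg _ (CycleRep.rep_comp_start hT hη))⟩
      filter_upwards [hη, hac.ae_eq hf'] with z h1 h2
      rw [h1, h2])
    (V := CycleRep.scaledSpace U n (CycleRep.coreSpace r ρ c hφ.toLp)) (by
      rw [CycleRep.coreSpace_eq_range hac hT, CycleRep.scaledSpace]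
      exact (LinearMap.range_comp _ _).symm)
  change CycleRep.IsMultiplicityFunction ρ _ fun x => (r^[n] ⁻¹' {x} ∩ {z | κ z ≠ 0}).encard
    at hmult
  rw [hκ] at hmult
  exact ⟨hV, hmult, fun d hd => hd.ae_eq hmult⟩
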